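/- Let $0\le T_0<T$ and let $(\mathbf u,p)$ be a classical solution of the 3D incompressible Euler equations $\mathbf u_t+\mathbf u\cdot\nabla\mathbf u=-\nabla p$, $\nabla\cdot\mathbf u=0$ on $\mathbb R^3\times[0,T)$, with $\mathbf u$ of class $C^2$ in $(\mathbf x,t)$ and $p$ differentiable in $\mathbf x$. Let $\omega=\nabla\times\mathbf u$ and, where $\omega\ne0$, put $\xi=\omega/|\omega|$, $\tau=\nabla\cdot\xi$, $\kappa=|\xi\cdot\nabla\xi|$ and $\xi^\perp=(\xi\cdot\nabla\xi)/|\xi\cdot\nabla\xi|$ (with $\xi^\perp=0$ where $\kappa=0$). For $T_0\le t<T$ let $L^t=\{\mathbf x(s,t):0\le s\le L(t)\}$, $L(t)>0$, be vortex line segments parameterized by arclength, i.e. $\omega\neq0$ on $L^t$ and $\partial_s\mathbf x(s,t)=\xi(\mathbf x(s,t),t)$, which come from the same vortex line: there is a vortex line $\gamma(\beta)$, $\beta\in I$, at time $T_0$, on which $\omega(\cdot,T_0)\ne 0$, with arclength parameter $\beta$ (so $\gamma'=\xi(\gamma,T_0)$), whose points have particle trajectories $X(t,\gamma(\beta))$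 (that is, $X(T_0,a)=a$ and $\partial_tX(t,a)=\mathbf u(X(t,a),t)$) on $[T_0,T)$, and there are continuous functions $\beta_1<\beta_2$ on $[T_0,T)$ with values in $I$ such that $L^t$ is the flow image of the piece $\beta_1(t)\le\beta\le\beta_2(t)$; precisely, for each $t$ there is a continuous map $\beta\mapsto s(\beta,t)$ from $[\beta_1(t),\beta_2(t)]$ to $[0,L(t)]$ with $s(\beta_1(t),t)=0$, $s(\beta_2(t),t)=L(t)$ and $\mathbf x(s(\beta,t),t)=X(t,\gamma(\beta))$. (No $L^{t}$ is assumed to be contained in the flow image of an earlier segment.) Define $$Q(t)=\frac1{L(t)}\int_0^{L(t)}|\omega(\mathbf x(s,t),t)|\,ds .$$ Then at every $t\in[T_0,T)$ at which $L$ and $\mathbf x(0,\cdot)$ are differentiable, with derivatives $L_t$ and $\frac{d\mathbf x}{dt}(0,t)$, all the integrands below and that of $Q$ are integrable, $Q$ is differentiable, and $$\begin{aligned} \frac{dQ}{dt}={}&\frac1L\left(\int_0^{L}2\tau|\omega|(\mathbf u\cdot\xi)\,ds-\int_0^{L}\kappa|\omega|(\mathbf u\cdot\xi^\perp)\,ds-\int_0^{L}\kappa\bigl(|\omega(\mathbf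 x(s,t),t)|-|\omega(\mathbf x(L,t),t)|\bigr)(\mathbf u\cdot\xi^\perp)\,ds\right)\\ &+\frac1L\bigl[(\mathbf u\cdot\xi)(\mathbf x(L,t),t)-(\mathbf u\cdot\xi)(\mathbf x(0,t),t)\bigr]\,|\omega(\mathbf x(L,t),t)|\\ &+\frac1L\bigl[|\omega(\mathbf x(L,t),t)|-|\omega(\mathbf x(0,t),t)|\bigr]\left(\frac{d\mathbf x}{dt}\cdot\xi+\mathbf u\cdot\xi\right)(\mathbf x(0,t),t)\\ &+\frac{L_t}{L}\bigl(|\omega(\mathbf x(L,t),t)|-Q\bigr), \end{aligned}$$ where $L=L(t)$, the functions under the integrals are evaluated at $(\mathbf x(s,t),t)$, and at $t=T_0$ all time derivatives are one-sided. -/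

import Mathlib

open Set MeasureTheory

noncomputable section

namespace VortexSegment

/-- Euclidean three-space. -/
abbrev E3 : Type := EuclideanSpace ℝ (Fin 3)

/-- `partialD f x i j` is the partial derivative of the `j`-th component of `f` in the
direction of the `i`-th coordinate, at `x`. -/
def partialD (f : E3 → E3) (x : E3) (i j : Fin 3) : ℝ :=
  (fderiv ℝ f x (EuclideanSpace.single i 1)) j

/-- The divergence of a vector field. -/
def divergence (f : E3 → E3) (x : E3) : ℝ := ∑ i : Fin 3, partialD f x i i

/-- The curl of a vector field. -/
def curl (f : E3 → E3) (x : E3) : E3 :=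
  !₂[partialD f x 1 2 - partialD f x 2 1,
     partialD f x 2 0 - partialD f x 0 2,
     partialD f x 0 1 - partialD f x 1 0]

/-- `(u, p)` is a classical solution of the incompressible Euler equations
`u_t + (u · ∇) u = - ∇ p`, `∇ · u = 0` on `[0, T) × ℝ³` (the time derivative at `t = 0`
being one-sided), with `u` of class `C²` in `(t, x)`. -/
structure IsEulerSolution (u : ℝ → E3 → E3) (p : ℝ → E3 → ℝ) (T : ℝ) : Prop where
  regular : ContDiffOn ℝ 2 (fun q : ℝ × E3 => u q.1 q.2) (Ico 0 T ×ˢ univ)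
  pressure : ∀ t ∈ Ico 0 T, Differentiable ℝ (p t)
  momentum : ∀ t ∈ Ico 0 T, ∀ x : E3,
    derivWithin (fun r => u r x) (Ico 0 T) t + fderiv ℝ (u t) x (u t x)
      = - gradient (p t) x
  incompressible : ∀ t ∈ Ico 0 T, ∀ x : E3, divergence (u t) x = 0

/-- The vorticity `ω = ∇ × u` at time `t`. -/
def vorticity (u : ℝ → E3 → E3) (t : ℝ) (x : E3) : E3 := curl (u t) x

/-- The vorticity direction `ξ = ω / |ω|` (meaningful where `ω ≠ 0`). -/
def xi (u : ℝ → E3 → E3) (t : ℝ) (x : E3) : E3 :=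
  ‖vorticity u t x‖⁻¹ • vorticity u t x

/-- The curvature vector `(ξ · ∇) ξ`. -/
def curvatureVector (u : ℝ → E3 → E3) (t : ℝ) (x : E3) : E3 :=
  fderiv ℝ (xi u t) x (xi u t x)

/-- The unsigned curvature `κ = |(ξ · ∇) ξ|`. -/
def kappa (u : ℝ → E3 → E3) (t : ℝ) (x : E3) : ℝ := ‖curvatureVector u t x‖

/-- The unit normal `ξ^⊥ = (ξ · ∇) ξ / |(ξ · ∇) ξ|`; it is set to `0` where `κ = 0`, and is
only used multiplied by `κ`. -/
def xiPerp (u : ℝ → E3 → E3) (t : ℝ) (x : E3) : E3 :=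
  ‖curvatureVector u t x‖⁻¹ • curvatureVector u t x

/-- `τ = ∇ · ξ`. -/
def tau (u : ℝ → E3 → E3) (t : ℝ) (x : E3) : ℝ := divergence (xi u t) x

/-- The tangential velocity `u · ξ`. -/
def uXi (u : ℝ → E3 → E3) (t : ℝ) (x : E3) : ℝ := inner ℝ (u t x) (xi u t x)

/-- The normal velocity `u · ξ^⊥`. -/
def uXiPerp (u : ℝ → E3 → E3) (t : ℝ) (x : E3) : ℝ := inner ℝ (u t x) (xiPerp u t x)

/-- `c`, restricted to the interval `I`, is a piece of a vortex line at time `t` parameterized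
by arclength: the vorticity does not vanish along `c`, and `dc/ds = ξ(c)` (a unit vector). -/
def IsVortexLine (u : ℝ → E3 → E3) (t : ℝ) (I : Set ℝ) (c : ℝ → E3) : Prop :=
  I.OrdConnected ∧ ∀ s ∈ I, vorticity u t (c s) ≠ 0 ∧ HasDerivWithinAt c (xi u t (c s)) I s

/-- `X` is the particle flow of `u` from time `T₀`, for the particles starting in `A`:
`X(T₀, a) = a` and `∂X/∂t (t, a) = u(X(t, a), t)` for `T₀ ≤ t < T`. -/
def IsParticleFlow (u : ℝ → E3 → E3) (T₀ T : ℝ) (A : Set E3) (X : ℝ → E3 → E3) : Prop :=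
  ∀ a ∈ A, X T₀ a = a ∧
    ∀ t ∈ Ico T₀ T, HasDerivWithinAt (fun r => X r a) (u t (X t a)) (Ico T₀ T) t

/-- The segments `{x(s, t) : 0 ≤ s ≤ L(t)}`, `T₀ ≤ t < T`, come from the same vortex line:
there is a vortex line `γ(β)`, `β ∈ I`, at time `T₀` (with arclength parameter `β`) such that
the segment at time `t` is the image of the piece `β₁(t) ≤ β ≤ β₂(t)` of it under the
particle flow. Here `σ(β, t)` is the value of the parameter `s` at the particle with
label `β`, so that `σ(β₁(t), t) = 0` and `σ(β₂(t), t) = L(t)`. -/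
def FromSameVortexLine (u : ℝ → E3 → E3) (T₀ T : ℝ) (x : ℝ → ℝ → E3) (L : ℝ → ℝ) : Prop :=
  ∃ (I : Set ℝ) (γ : ℝ → E3) (X : ℝ → E3 → E3) (β₁ β₂ : ℝ → ℝ) (σ : ℝ → ℝ → ℝ),
    IsVortexLine u T₀ I γ ∧
    IsParticleFlow u T₀ T (γ '' I) X ∧
    ContinuousOn β₁ (Ico T₀ T) ∧ ContinuousOn β₂ (Ico T₀ T) ∧
    ∀ t ∈ Ico T₀ T,
      β₁ t ∈ I ∧ β₂ t ∈ I ∧ β₁ t < β₂ t ∧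
      ContinuousOn (fun β => σ β t) (Icc (β₁ t) (β₂ t)) ∧
      MapsTo (fun β => σ β t) (Icc (β₁ t) (β₂ t)) (Icc 0 (L t)) ∧
      σ (β₁ t) t = 0 ∧ σ (β₂ t) t = L t ∧
      ∀ β ∈ Icc (β₁ t) (β₂ t), x (σ β t) t = X t (γ β)

/-- `x(s, t)`, `0 ≤ s ≤ L(t)`, `T₀ ≤ t < T`, is a family of vortex line segments of positive
length `L(t)`, parameterized by arclength `s`, which come from the same vortex line. -/
structure IsVortexSegmentFamily (u : ℝ → E3 → E3) (T₀ T : ℝ) (x : ℝ → ℝ → E3)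
    (L : ℝ → ℝ) : Prop where
  length_pos : ∀ t ∈ Ico T₀ T, 0 < L t
  segment : ∀ t ∈ Ico T₀ T, IsVortexLine u t (Icc 0 (L t)) (fun s => x s t)
  same_line : FromSameVortexLine u T₀ T x L

/-- `Q(t)`, the mean of `|ω|` over the segment at time `t`. -/
def meanVorticity (u : ℝ → E3 → E3) (x : ℝ → ℝ → E3) (L : ℝ → ℝ) (t : ℝ) : ℝ :=
  1 / L t * ∫ s in (0 : ℝ)..(L t), ‖vorticity u t (x s t)‖

end VortexSegment

end

/-! Everything is computed in the Lagrangian label β, in which a segment becomes a moving interval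
[β₁(t), β₂(t)]. The curl of the momentum equation gives ω' = ∇u ω along trajectories. So
ω(X(t,γ(β)),t)/|ω₀(γ(β))| solves the linearised flow equation with initial value γ'(β), and hence
equals ∂_β X(t,γ(β)) (`IsEulerSolution.hasDerivWithinAt_flow`). The arclength density is therefore G
= ds/dβ = |ω|/|ω₀|. With the stretching rate α = ξ·∇u·ξ, |ω|' = α|ω| along trajectories, so G' = αG
and (|ω|G)' = 2α|ω|G.

The end labels are assumed only continuous. The differentiability of x(0,·) forces that of β₁,
because ∂_βX ≠ 0; the differentiability of L = ∫G dβ then forces that of β₂, because G ≠ 0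
(`exists_hasDerivWithinAt_integral_of_moving_piece`). Leibniz' rule yields, with e₁, e₂ the end
point speeds relative to the fluid, (∫|ω|ds)_t = ∫2α|ω|ds + |ω(L)|e₂ − |ω(0)|e₁, L_t = ∫α ds + e₂ −
e₁, x_t·ξ = u·ξ + e₁ at s = 0.

At fixed time, ∂_s(u·ξ) = α + κ u·ξ^⊥, and ∂_s|ω| = −τ|ω| because div(|ω|ξ) = 0. Integrating these
removes α; eliminating e₁, e₂ from the quotient rule for Q leaves the stated formula. -/

namespace VortexSegment

open Filter Topology Asymptotics

/-! ### Uniform expansions, an implicit differentiability criterion, and a Grönwall barrier. -/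

section Calculus

variable {E : Type*} [NormedAddCommGroup E] [NormedSpace ℝ E]

/-- First order expansion in a parameter, uniformly with respect to a variable in a
compact set. -/
theorem eventually_forall_norm_sub_sub_le {P : Type*} [TopologicalSpace P]
    {F F' : ℝ → P → E} {J : Set ℝ} {K : Set P} {t : ℝ}
    (hJ : Convex ℝ J) (ht : t ∈ J) (hK : IsCompact K)
    (hF : ∀ β ∈ K, ∀ r ∈ J, HasDerivWithinAt (fun r => F r β) (F' r β) J r)
    (hF' : ContinuousOn (fun q : ℝ × P => F' q.1 q.2) (J ×ˢ K)) {ε : ℝ} (hε : 0 < ε) :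
    ∀ᶠ r in 𝓝[J] t, ∀ β ∈ K, ‖F r β - F t β - (r - t) • F' t β‖ ≤ ε * |r - t| := by
  -- Compactness of `K` makes `F' r β` close to `F' t β` for all β at once when r is near t.
  obtain ⟨v, hv, hvK⟩ := hK.mem_uniformity_of_prod (f := F') (s := J) (q := t)
    hF' ht (Metric.dist_mem_uniformity hε)
  obtain ⟨δ, hδ, hsub⟩ := Metric.mem_nhdsWithin_iff.1 hv
  filter_upwards [inter_mem_nhdsWithin J (Metric.ball_mem_nhds t hδ)] with r hr β hβ
  have hconv : Convex ℝ (J ∩ Metric.ball t δ) := hJ.inter (convex_ball t δ)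
  have key := hconv.norm_image_sub_le_of_norm_hasDerivWithin_le (C := ε)
    (f := fun s => F s β - s • F' t β) (f' := fun s => F' s β - F' t β) (x := t) (y := r)
    (fun s hs => by
      have h2 : HasDerivWithinAt (fun s : ℝ => s • F' t β) ((1 : ℝ) • F' t β)
          (J ∩ Metric.ball t δ) s := (hasDerivWithinAt_id s _).smul_const _
      rw [one_smul] at h2
      exact ((hF β hβ s hs.1).mono inter_subset_left).sub h2)
    (fun s hs => by
      have := hvK s (hsub ⟨hs.2, hs.1⟩) β hβ
      rw [← dist_eq_norm]
      exact le_of_lt this)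
    ⟨ht, Metric.mem_ball_self hδ⟩ hr
  rw [Real.norm_eq_abs] at key
  convert key using 2
  rw [sub_smul]; abel

/-- Joint differentiability from a uniform expansion in the first variable and
differentiability in the second one. -/
theorem hasFDerivWithinAt_prod_of_uniform {F : ℝ → ℝ → E} {J K : Set ℝ} {t b : ℝ}
    {Ft : ℝ → E} {v : E}
    (hU : ∀ ε : ℝ, 0 < ε → ∀ᶠ r in 𝓝[J] t, ∀ β ∈ K,
      ‖F r β - F t β - (r - t) • Ft β‖ ≤ ε * |r - t|)
    (hc : ContinuousWithinAt Ft K b) (hd : HasDerivWithinAt (F t) v K b) :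
    HasFDerivWithinAt (fun q : ℝ × ℝ => F q.1 q.2)
      ((ContinuousLinearMap.fst ℝ ℝ ℝ).smulRight (Ft b) +
        (ContinuousLinearMap.snd ℝ ℝ ℝ).smulRight v) (J ×ˢ K) (t, b) := by
  refine HasFDerivWithinAt.of_isLittleO (isLittleO_iff.2 fun ε hε => ?_)
  have h1 := hU (ε / 3) (by positivity)
  have h2 : ∀ᶠ β in 𝓝[K] b, ‖Ft β - Ft b‖ ≤ ε / 3 := by
    filter_upwards [hc.eventually (Metric.ball_mem_nhds (Ft b) (ε := ε / 3) (by positivity))]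
      with β hβ
    rw [← dist_eq_norm]
    exact le_of_lt hβ
  have h3 := isLittleO_iff.1 (hasDerivWithinAt_iff_isLittleO.1 hd)
    (show (0 : ℝ) < ε / 3 by positivity)
  rw [nhdsWithin_prod_eq]
  have hK : ∀ᶠ β in 𝓝[K] b, β ∈ K := self_mem_nhdsWithin
  filter_upwards [h1.prod_mk ((h2.and h3).and hK)] with q hq
  obtain ⟨hq1, ⟨hq2, hq3⟩, hqK⟩ := hq
  -- The remainder splits into the time increment at the displaced point `q.2`, the variation of the
  -- time derivative between `b` and `q.2`, and the increment in the second variable at time `t`;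
  -- each gets ε/3.
  have e : F q.1 q.2 - F t b - ((ContinuousLinearMap.fst ℝ ℝ ℝ).smulRight (Ft b) +
        (ContinuousLinearMap.snd ℝ ℝ ℝ).smulRight v) (q - (t, b))
      = (F q.1 q.2 - F t q.2 - (q.1 - t) • Ft q.2) + (q.1 - t) • (Ft q.2 - Ft b)
        + (F t q.2 - F t b - (q.2 - b) • v) := by
    simp only [add_apply, ContinuousLinearMap.smulRight_apply,
      ContinuousLinearMap.coe_fst', ContinuousLinearMap.coe_snd', Prod.fst_sub, Prod.snd_sub,
      smul_sub]
    abel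
  have n1 : |q.1 - t| ≤ ‖q - (t, b)‖ := by
    simpa using norm_fst_le (q - (t, b))
  have n2 : |q.2 - b| ≤ ‖q - (t, b)‖ := by
    simpa using norm_snd_le (q - (t, b))
  rw [e]
  have m2 : ‖(q.1 - t) • (Ft q.2 - Ft b)‖ ≤ |q.1 - t| * (ε / 3) := by
    rw [norm_smul, Real.norm_eq_abs]
    gcongr
  rw [Real.norm_eq_abs] at hq3
  have := hq1 q.2 hqK
  calc _ ≤ ε / 3 * |q.1 - t| + |q.1 - t| * (ε / 3) + ε / 3 * |q.2 - b| :=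
        (norm_add₃_le).trans (by gcongr)
    _ ≤ ε / 3 * ‖q - (t, b)‖ + ‖q - (t, b)‖ * (ε / 3) + ε / 3 * ‖q - (t, b)‖ := by gcongr
    _ = ε * ‖q - (t, b)‖ := by ring

/-- If `r ↦ Φ (r, b r)` is differentiable, where `b` is continuous and the partial derivative
of `Φ` in the second variable does not vanish, then `b` is differentiable. -/
theorem exists_hasDerivWithinAt_of_hasFDerivWithinAt {Φ : ℝ × ℝ → E} {a v y : E}
    {J K : Set ℝ} {b : ℝ → ℝ} {t : ℝ} (hJ : UniqueDiffWithinAt ℝ J t)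
    (hΦ : HasFDerivWithinAt Φ ((ContinuousLinearMap.fst ℝ ℝ ℝ).smulRight a +
        (ContinuousLinearMap.snd ℝ ℝ ℝ).smulRight v) (J ×ˢ K) (t, b t))
    (hv : v ≠ 0) (hb : ContinuousWithinAt b J t) (hbK : MapsTo b J K)
    (hy : HasDerivWithinAt (fun r => Φ (r, b r)) y J t) :
    ∃ c : ℝ, HasDerivWithinAt b c J t ∧ y = a + c • v := by
  -- Testing with a functional normalised by ℓ(v) = 1 isolates the scalar increment of `b`.
  obtain ⟨ℓ, hℓ⟩ := SeparatingDual.exists_eq_one (R := ℝ) hv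
  have htend : Tendsto (fun r => (r, b r)) (𝓝[J] t) (𝓝[J ×ˢ K] (t, b t)) := by
    rw [nhdsWithin_prod_eq]
    exact tendsto_id.prodMk (hb.tendsto_nhdsWithin hbK)
  have hR := (hΦ.isLittleO.comp_tendsto htend)
  have hy' := hasDerivWithinAt_iff_isLittleO.1 hy
  -- the difference `b r - b t - (r - t) ℓ (y - a)` is small compared to `(r - t, b r - b t)`
  have hS : (fun r => b r - b t - (r - t) • ℓ (y - a)) =o[𝓝[J] t]
      fun r => |r - t| + |b r - b t| := by
    have h1 : (fun r => Φ (r, b r) - Φ (t, b t) - (r - t) • y) =o[𝓝[J] t]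
        fun r => |r - t| + |b r - b t| :=
      hy'.trans_le fun r => by
        rw [Real.norm_eq_abs, Real.norm_eq_abs, abs_of_nonneg (a := _ + _) (by positivity)]
        linarith [abs_nonneg (b r - b t)]
    have h2 : (fun r => Φ (r, b r) - Φ (t, b t) - ((r - t) • a + (b r - b t) • v)) =o[𝓝[J] t]
        fun r => |r - t| + |b r - b t| := by
      refine IsLittleO.trans_le (g := fun r => ((r, b r) - (t, b t) : ℝ × ℝ)) ?_ fun r => ?_
      · refine hR.congr (fun r => ?_) (fun r => rfl)
        simp
      · rw [Real.norm_eq_abs, abs_of_nonneg (a := _ + _) (by positivity), Prod.norm_def]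
        simp [abs_nonneg]
    have h3 := (ℓ.isBigO_comp (fun r => (Φ (r, b r) - Φ (t, b t) - (r - t) • y) -
      (Φ (r, b r) - Φ (t, b t) - ((r - t) • a + (b r - b t) • v))) (𝓝[J] t)).trans_isLittleO
      (h1.sub h2)
    refine h3.congr_left fun r => ?_
    simp only [map_sub, map_add, map_smul, hℓ, smul_eq_mul]
    ring
  -- With the little-o constant 1/2, half of |b r − b t| is absorbed on the left. This bounds the
  -- increment of `b` by that of the time, so the error in `hS` is in fact o(r − t).
  have hO : (fun r => |r - t| + |b r - b t|) =O[𝓝[J] t] fun r => r - t := by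
    refine IsBigO.of_bound (2 * (‖ℓ (y - a)‖ + 2)) ?_
    filter_upwards [isLittleO_iff.1 hS (show (0 : ℝ) < 1 / 2 by norm_num)] with r hr
    rw [Real.norm_eq_abs, Real.norm_eq_abs, abs_of_nonneg (a := _ + _) (by positivity)] at *
    have h4 : |b r - b t| ≤ |b r - b t - (r - t) • ℓ (y - a)| + |(r - t) • ℓ (y - a)| := by
      simpa using abs_add_le (b r - b t - (r - t) • ℓ (y - a)) ((r - t) • ℓ (y - a))
    rw [smul_eq_mul] at hr h4
    rw [abs_mul] at h4
    rw [Real.norm_eq_abs]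
    nlinarith [abs_nonneg (r - t), abs_nonneg (b r - b t), abs_nonneg (ℓ (y - a))]
  have hc : HasDerivWithinAt b (ℓ (y - a)) J t :=
    hasDerivWithinAt_iff_isLittleO.2 (hS.trans_isBigO hO)
  refine ⟨_, hc, ?_⟩
  have hcomp : HasDerivWithinAt (fun r => Φ (r, b r)) (a + ℓ (y - a) • v) J t := by
    have h5 := HasFDerivWithinAt.comp_hasDerivWithinAt (f := fun r => (r, b r)) t hΦ
      ((hasDerivWithinAt_id t J).prodMk hc) (fun r hr => ⟨hr, hbK hr⟩)
    exact h5.congr_deriv (by simp)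
  exact hJ.eq_deriv _ hy hcomp

/-- A fencing form of Grönwall's inequality: the differential inequality is needed only
where the bound is attained. -/
theorem norm_le_mul_exp_of_deriv {f f' : ℝ → E} {a c K η : ℝ}
    (hf : ∀ r ∈ Icc a c, HasDerivWithinAt f (f' r) (Icc a c) r) (ha : ‖f a‖ ≤ η)
    (bound : ∀ r ∈ Ico a c, ‖f r‖ = η * Real.exp (K * (r - a)) → ‖f' r‖ < K * ‖f r‖) :
    ∀ r ∈ Icc a c, ‖f r‖ ≤ η * Real.exp (K * (r - a)) := by
  refine image_norm_le_of_norm_deriv_right_lt_deriv_boundary (f := f) (f' := f')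
    (B := fun r => η * Real.exp (K * (r - a)))
    (B' := fun r => K * (η * Real.exp (K * (r - a))))
    (fun r hr => (hf r hr).continuousWithinAt) (fun r hr => ?_) (by simpa using ha)
    (fun r => ?_) (fun r hr h => ?_)
  · exact (hf r (Ico_subset_Icc_self hr)).mono_of_mem_nhdsWithin (Icc_mem_nhdsGE_of_mem hr)
  · have h1 : HasDerivAt (fun r => K * (r - a)) K r := by
      simpa using ((hasDerivAt_id r).sub_const a).const_mul K
    have h2 := (h1.exp).const_mul η
    exact h2.congr_deriv (by ring)
  · rw [← h]; exact bound r hr h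

end Calculus

/-! ### Differentiation of integrals in a parameter and an end point. -/

section Integral

/-- Leibniz' rule for an integral with a parameter and a variable end point. -/
theorem hasFDerivWithinAt_integral_prod {F F' : ℝ → ℝ → ℝ} {J : Set ℝ} {a c t b : ℝ}
    (hJ : Convex ℝ J) (ht : t ∈ J) (hb : b ∈ Icc a c)
    (hF : ∀ β ∈ Icc a c, ∀ r ∈ J, HasDerivWithinAt (fun r => F r β) (F' r β) J r)
    (hFc : ∀ r ∈ J, ContinuousOn (F r) (Icc a c))
    (hF' : ContinuousOn (fun q : ℝ × ℝ => F' q.1 q.2) (J ×ˢ Icc a c)) :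
    HasFDerivWithinAt (fun q : ℝ × ℝ => ∫ β in a..q.2, F q.1 β)
      ((ContinuousLinearMap.fst ℝ ℝ ℝ).smulRight (∫ β in a..b, F' t β) +
        (ContinuousLinearMap.snd ℝ ℝ ℝ).smulRight (F t b)) (J ×ˢ Icc a c) (t, b) := by
  have hac : a ≤ c := hb.1.trans hb.2
  have hint : ∀ {G : ℝ → ℝ}, ContinuousOn G (Icc a c) → ∀ β ∈ Icc a c,
      IntervalIntegrable G volume a β := fun hG β hβ =>
    ContinuousOn.intervalIntegrable (hG.mono (by
      rw [uIcc_of_le hβ.1]; exact Icc_subset_Icc_right hβ.2))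
  have hder : ∀ {G : ℝ → ℝ}, ContinuousOn G (Icc a c) →
      HasDerivWithinAt (fun β => ∫ x in a..β, G x) (G b) (Icc a c) b := fun {G} hG => by
    have : Fact (b ∈ Icc a c) := ⟨hb⟩
    exact intervalIntegral.integral_hasDerivWithinAt_right (hint hG b hb)
      (hG.stronglyMeasurableAtFilter_nhdsWithin measurableSet_Icc b) (hG b hb)
  have hF't : ContinuousOn (F' t) (Icc a c) :=
    hF'.comp (continuousOn_const.prodMk continuousOn_id) fun β hβ => ⟨ht, hβ⟩
  refine hasFDerivWithinAt_prod_of_uniform (F := fun r β => ∫ x in a..β, F r x)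
    (Ft := fun β => ∫ x in a..β, F' t x) (fun ε hε => ?_) (hder hF't).continuousWithinAt
    (hder (hFc t ht))
  -- The added 1 keeps the divisor positive when the interval degenerates to a point.
  have hpos : 0 < c - a + 1 := by linarith
  filter_upwards [eventually_forall_norm_sub_sub_le hJ ht isCompact_Icc hF hF'
    (div_pos hε hpos), self_mem_nhdsWithin] with r hr hrJ β hβ
  have hi := hint (hFc r hrJ) β hβ
  have hj := hint (hFc t ht) β hβ
  have hk : IntervalIntegrable (fun x => (r - t) • F' t x) volume a β :=
    hint (hF't.const_smul (r - t)) β hβ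
  rw [← intervalIntegral.integral_smul, ← intervalIntegral.integral_sub hi hj,
    ← intervalIntegral.integral_sub (hi.sub hj) hk]
  have h1 := intervalIntegral.norm_integral_le_of_norm_le_const (a := a) (b := β)
    (f := fun x => F r x - F t x - (r - t) • F' t x) (C := ε / (c - a + 1) * |r - t|)
    (fun x hx => by
      rw [uIoc_of_le hβ.1] at hx
      exact hr x ⟨hx.1.le, hx.2.trans hβ.2⟩)
  refine h1.trans ?_
  rw [abs_of_nonneg (sub_nonneg.2 hβ.1)]
  have h2 : β - a ≤ c - a + 1 := by linarith [hβ.2]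
  calc ε / (c - a + 1) * |r - t| * (β - a)
      ≤ ε / (c - a + 1) * |r - t| * (c - a + 1) := by gcongr
    _ = ε * |r - t| := by field_simp

end Integral

/-! ### The curl as a linear map on matrices. -/

section LinearAlgebra

/-- The curl of a vector field as a linear function of its derivative. -/
noncomputable def curlL : (E3 →L[ℝ] E3) →L[ℝ] E3 :=
  LinearMap.toContinuousLinearMap
    { toFun := fun A =>
        !₂[A (EuclideanSpace.single 1 1) 2 - A (EuclideanSpace.single 2 1) 1,
           A (EuclideanSpace.single 2 1) 0 - A (EuclideanSpace.single 0 1) 2,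
           A (EuclideanSpace.single 0 1) 1 - A (EuclideanSpace.single 1 1) 0]
      map_add' := fun A B => by
        ext i; fin_cases i <;> simp <;> ring
      map_smul' := fun c A => by
        ext i; fin_cases i <;> simp <;> ring }

theorem curlL_apply (A : E3 →L[ℝ] E3) : curlL A =
    !₂[A (EuclideanSpace.single 1 1) 2 - A (EuclideanSpace.single 2 1) 1,
       A (EuclideanSpace.single 2 1) 0 - A (EuclideanSpace.single 0 1) 2,
       A (EuclideanSpace.single 0 1) 1 - A (EuclideanSpace.single 1 1) 0] := rfl

theorem curl_eq_curlL (f : E3 → E3) (x : E3) : curl f x = curlL (fderiv ℝ f x) := rfl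

theorem eq_sum_single (v : E3) : v = ∑ i, v i • EuclideanSpace.single i (1 : ℝ) := by
  ext j
  fin_cases j <;> simp [Fin.sum_univ_three]

theorem clm_apply_apply_eq_sum (A : E3 →L[ℝ] E3) (v : E3) (j : Fin 3) :
    A v j = ∑ i, v i * A (EuclideanSpace.single i 1) j := by
  conv_lhs => rw [eq_sum_single v]
  simp [Fin.sum_univ_three]

/-- The curl sees only the antisymmetric part of the matrix. This is how the pressure Hessian drops
out of the vorticity equation. -/
theorem curlL_eq_zero_of_symm {B : E3 →L[ℝ] E3}
    (hB : ∀ v w, inner ℝ (B v) w = inner ℝ (B w) v) : curlL B = 0 := by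
  have h : ∀ i j : Fin 3, B (EuclideanSpace.single i 1) j = B (EuclideanSpace.single j 1) i := by
    intro i j
    simpa [EuclideanSpace.inner_single_right] using
      hB (EuclideanSpace.single i 1) (EuclideanSpace.single j 1)
  rw [curlL_apply, h 1 2, h 2 0, h 0 1]
  ext i; fin_cases i <;> simp

/-- The curl of the square of a trace-free matrix. -/
theorem curlL_comp_self {A : E3 →L[ℝ] E3}
    (hA : ∑ i : Fin 3, A (EuclideanSpace.single i 1) i = 0) :
    curlL (A.comp A) = - A (curlL A) := by
  have h2 : ∀ i j : Fin 3, (A.comp A) (EuclideanSpace.single i 1) j =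
      ∑ k, A (EuclideanSpace.single i 1) k * A (EuclideanSpace.single k 1) j := fun i j =>
    clm_apply_apply_eq_sum A _ j
  rw [curlL_apply (A.comp A)]
  simp only [h2]
  have h3 : ∀ j, (-A (curlL A)) j = - ∑ i, (curlL A) i * A (EuclideanSpace.single i 1) j :=
    fun j => by rw [← clm_apply_apply_eq_sum]; rfl
  rw [Fin.sum_univ_three] at hA
  ext j
  rw [h3, curlL_apply]
  -- For every matrix, curl(A²) + A curl A = (tr A) curl A; each component is this identity with tr
  -- A = 0.
  fin_cases j <;> simp [Fin.sum_univ_three]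
  · linear_combination (A (EuclideanSpace.single 1 1) 2 - A (EuclideanSpace.single 2 1) 1) * hA
  · linear_combination (A (EuclideanSpace.single 2 1) 0 - A (EuclideanSpace.single 0 1) 2) * hA
  · linear_combination (A (EuclideanSpace.single 0 1) 1 - A (EuclideanSpace.single 1 1) 0) * hA

end LinearAlgebra

/-! ### The vorticity equation along trajectories. -/

section Euler

/-- The derivative of the velocity with respect to time and space. -/
noncomputable def velD (u : ℝ → E3 → E3) (T : ℝ) (q : ℝ × E3) : ℝ × E3 →L[ℝ] E3 :=
  fderivWithin ℝ (fun q : ℝ × E3 => u q.1 q.2) (Ico 0 T ×ˢ univ) q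

/-- The second derivative of the velocity with respect to time and space. -/
noncomputable def velDD (u : ℝ → E3 → E3) (T : ℝ) (q : ℝ × E3) :
    ℝ × E3 →L[ℝ] ℝ × E3 →L[ℝ] E3 :=
  fderivWithin ℝ (velD u T) (Ico 0 T ×ˢ univ) q

theorem uniqueDiffOn_slab (T : ℝ) : UniqueDiffOn ℝ (Ico 0 T ×ˢ (univ : Set E3)) :=
  (uniqueDiffOn_Ico 0 T).prod uniqueDiffOn_univ

variable {u : ℝ → E3 → E3} {p : ℝ → E3 → ℝ} {T t : ℝ} {x : E3}

theorem IsEulerSolution.hasFDerivWithinAt (hu : IsEulerSolution u p T) (ht : t ∈ Ico 0 T)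
    (x : E3) : HasFDerivWithinAt (fun q : ℝ × E3 => u q.1 q.2) (velD u T (t, x))
      (Ico 0 T ×ˢ univ) (t, x) :=
  ((hu.regular.differentiableOn (by norm_num)) (t, x) ⟨ht, mem_univ _⟩).hasFDerivWithinAt

theorem IsEulerSolution.contDiffOn_velD (hu : IsEulerSolution u p T) :
    ContDiffOn ℝ 1 (velD u T) (Ico 0 T ×ˢ univ) :=
  hu.regular.fderivWithin (uniqueDiffOn_slab T) (by norm_num)

theorem IsEulerSolution.hasFDerivWithinAt_velD (hu : IsEulerSolution u p T)
    (ht : t ∈ Ico 0 T) (x : E3) : HasFDerivWithinAt (velD u T) (velDD u T (t, x))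
      (Ico 0 T ×ˢ univ) (t, x) :=
  ((hu.contDiffOn_velD.differentiableOn (by norm_num)) (t, x) ⟨ht, mem_univ _⟩).hasFDerivWithinAt

theorem mapsTo_slab (ht : t ∈ Ico 0 T) (s : Set E3) :
    MapsTo (fun y : E3 => (t, y)) s (Ico 0 T ×ˢ univ) := fun _ _ => ⟨ht, mem_univ _⟩

theorem hasFDerivAt_slice {F : Type*} [NormedAddCommGroup F] [NormedSpace ℝ F]
    {f : ℝ × E3 → F} {f' : ℝ × E3 →L[ℝ] F} (ht : t ∈ Ico 0 T)
    (hf : HasFDerivWithinAt f f' (Ico 0 T ×ˢ univ) (t, x)) :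
    HasFDerivAt (fun y => f (t, y)) (f'.comp (ContinuousLinearMap.inr ℝ ℝ E3)) x := by
  have h := HasFDerivWithinAt.comp (f := fun y : E3 => (t, y)) x hf
    (hasFDerivAt_prodMk_right t x).hasFDerivWithinAt (mapsTo_slab ht univ)
  exact hasFDerivWithinAt_univ.1 h

theorem IsEulerSolution.hasFDerivAt (hu : IsEulerSolution u p T) (ht : t ∈ Ico 0 T) (x : E3) :
    HasFDerivAt (u t) ((velD u T (t, x)).comp (ContinuousLinearMap.inr ℝ ℝ E3)) x :=
  hasFDerivAt_slice ht (hu.hasFDerivWithinAt ht x)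

theorem IsEulerSolution.fderiv_eq (hu : IsEulerSolution u p T) (ht : t ∈ Ico 0 T) (x : E3) :
    fderiv ℝ (u t) x = (velD u T (t, x)).comp (ContinuousLinearMap.inr ℝ ℝ E3) :=
  (hu.hasFDerivAt ht x).fderiv

/-- The time slab is not open at t = 0, but mixed derivatives of a C² map still commute there
because the slab lies in the closure of its interior. -/
theorem IsEulerSolution.velD_symm (hu : IsEulerSolution u p T) (ht : t ∈ Ico 0 T) (x : E3)
    (v w : ℝ × E3) : velDD u T (t, x) v w = velDD u T (t, x) w v := by
  refine ContDiffWithinAt.isSymmSndFDerivWithinAt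
    (hu.regular (t, x) ⟨ht, mem_univ _⟩) (by simp) (uniqueDiffOn_slab T) ?_ ⟨ht, mem_univ _⟩ v w
  rw [interior_prod_eq, interior_univ, interior_Ico, closure_prod_eq, closure_univ,
    closure_Ioo (ht.1.trans_lt ht.2).ne]
  exact ⟨⟨ht.1, ht.2.le⟩, mem_univ _⟩

/-- The momentum equation in terms of the space-time derivative. -/
theorem IsEulerSolution.velD_material (hu : IsEulerSolution u p T) (ht : t ∈ Ico 0 T) (x : E3) :
    velD u T (t, x) (1, u t x) = - gradient (p t) x := by
  rw [← hu.momentum t ht x, hu.fderiv_eq ht x]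
  have h := HasFDerivWithinAt.comp_hasDerivWithinAt (f := fun r : ℝ => (r, x)) t
    (hu.hasFDerivWithinAt ht x) ((hasDerivWithinAt_id t (Ico 0 T)).prodMk
      (hasDerivWithinAt_const t _ x)) (fun r hr => ⟨hr, mem_univ _⟩)
  have h2 : derivWithin (fun r => u r x) (Ico 0 T) t = velD u T (t, x) (1, 0) :=
    h.derivWithin (uniqueDiffOn_Ico 0 T t ht)
  rw [h2, ContinuousLinearMap.comp_apply, ContinuousLinearMap.inr_apply, ← map_add]
  simp

/-- The derivative of the pressure gradient is symmetric. -/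
theorem IsEulerSolution.inner_pressure_symm (hu : IsEulerSolution u p T) (ht : t ∈ Ico 0 T)
    (x v w : E3) :
    inner ℝ (velDD u T (t, x) (0, v) (1, u t x) + velD u T (t, x) (0, velD u T (t, x) (0, v))) w
      = inner ℝ (velDD u T (t, x) (0, w) (1, u t x) +
          velD u T (t, x) (0, velD u T (t, x) (0, w))) v := by
  have hG : HasFDerivAt (fun y => velD u T (t, y) (1, u t y))
      (((velD u T (t, x)).comp ((0 : E3 →L[ℝ] ℝ).prod
        ((velD u T (t, x)).comp (ContinuousLinearMap.inr ℝ ℝ E3)))) +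
        (((velDD u T (t, x)).comp (ContinuousLinearMap.inr ℝ ℝ E3)).flip (1, u t x))) x :=
    (hasFDerivAt_slice ht (hu.hasFDerivWithinAt_velD ht x)).clm_apply
      ((hasFDerivAt_const (1 : ℝ) x).prodMk (hu.hasFDerivAt ht x))
  -- The pressure is assumed only once differentiable. The momentum equation identifies its gradient
  -- with minus the acceleration Du(1,u), which is differentiable by `hG`; so the pressure has a
  -- second derivative, and it is symmetric.
  have hp : ∀ y, HasFDerivAt (p t) (innerSL ℝ (-(velD u T (t, y) (1, u t y)))) y := fun y => by
    rw [hu.velD_material ht y, neg_neg]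
    exact ((hu.pressure t ht) y).hasGradientAt.hasFDerivAt
  have h2 := (innerSL ℝ (E := E3)).hasFDerivAt.comp x hG.neg
  have h3 := second_derivative_symmetric_of_eventually (Eventually.of_forall hp) h2 v w
  simp only [ContinuousLinearMap.comp_apply, neg_apply, add_apply,
    ContinuousLinearMap.prod_apply, ContinuousLinearMap.inr_apply,
    ContinuousLinearMap.flip_apply, zero_apply] at h3
  change inner ℝ (-_ : E3) w = inner ℝ (-_ : E3) v at h3
  rw [inner_neg_left, inner_neg_left, neg_inj] at h3
  rw [add_comm, h3, add_comm]

theorem IsEulerSolution.vorticity_eq (hu : IsEulerSolution u p T) (ht : t ∈ Ico 0 T) (x : E3) :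
    vorticity u t x = curlL ((velD u T (t, x)).comp (ContinuousLinearMap.inr ℝ ℝ E3)) := by
  rw [vorticity, curl_eq_curlL, hu.fderiv_eq ht]

theorem IsEulerSolution.contDiffOn_spatial (hu : IsEulerSolution u p T) :
    ContDiffOn ℝ 1 (fun q : ℝ × E3 => fderiv ℝ (u q.1) q.2) (Ico 0 T ×ˢ univ) :=
  (hu.contDiffOn_velD.clm_comp contDiffOn_const).congr fun q hq => hu.fderiv_eq hq.1 q.2

theorem IsEulerSolution.contDiffOn_vorticity (hu : IsEulerSolution u p T) :
    ContDiffOn ℝ 1 (fun q : ℝ × E3 => vorticity u q.1 q.2) (Ico 0 T ×ˢ univ) :=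
  curlL.contDiff.comp_contDiffOn hu.contDiffOn_spatial

/-- The vorticity equation along a particle trajectory. -/
theorem IsEulerSolution.hasDerivWithinAt_vorticity (hu : IsEulerSolution u p T) {J : Set ℝ}
    (hJ : J ⊆ Ico 0 T) {y : ℝ → E3} (ht : t ∈ J) (hy : HasDerivWithinAt y (u t (y t)) J t) :
    HasDerivWithinAt (fun r => vorticity u r (y r))
      (fderiv ℝ (u t) (y t) (vorticity u t (y t))) J t := by
  have h1 : HasDerivWithinAt (fun r => velD u T (r, y r))
      (velDD u T (t, y t) (1, u t (y t))) J t :=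
    HasFDerivWithinAt.comp_hasDerivWithinAt (f := fun r => (r, y r)) t
      (hu.hasFDerivWithinAt_velD (hJ ht) (y t)) ((hasDerivWithinAt_id t J).prodMk hy)
      (fun r hr => ⟨hJ hr, mem_univ _⟩)
  have h2 : HasDerivWithinAt
      (fun r => curlL ((velD u T (r, y r)).comp (ContinuousLinearMap.inr ℝ ℝ E3)))
      (curlL ((velDD u T (t, y t) (1, u t (y t))).comp (ContinuousLinearMap.inr ℝ ℝ E3))) J t := by
    have h3 := h1.clm_comp (hasDerivWithinAt_const t J (ContinuousLinearMap.inr ℝ ℝ E3))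
    have h4 := curlL.hasFDerivAt.comp_hasDerivWithinAt t h3
    exact h4.congr_deriv (by simp)
  have h5 : curlL ((velDD u T (t, y t) (1, u t (y t))).comp (ContinuousLinearMap.inr ℝ ℝ E3))
      = fderiv ℝ (u t) (y t) (vorticity u t (y t)) := by
    set A := fderiv ℝ (u t) (y t) with hAdef
    have hA : A = (velD u T (t, y t)).comp (ContinuousLinearMap.inr ℝ ℝ E3) :=
      hu.fderiv_eq (hJ ht) _
    -- The spatial derivative of the acceleration is the material derivative of ∇u plus (∇u)², after
    -- exchanging second derivatives. It is symmetric, so its curl vanishes; incompressibility then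
    -- turns the curl of (∇u)² into −∇u ω.
    have h6 : curlL ((velDD u T (t, y t) (1, u t (y t))).comp
        (ContinuousLinearMap.inr ℝ ℝ E3) + A.comp A) = 0 := by
      refine curlL_eq_zero_of_symm fun v w => ?_
      have := hu.inner_pressure_symm (hJ ht) (y t) v w
      rw [hu.velD_symm (hJ ht) (y t) (0, v), hu.velD_symm (hJ ht) (y t) (0, w)] at this
      simpa [hA] using this
    have h7 : curlL (A.comp A) = - A (curlL A) :=
      curlL_comp_self (hu.incompressible t (hJ ht) (y t))
    rw [map_add, h7] at h6
    rw [vorticity, curl_eq_curlL, ← hAdef]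
    exact add_neg_eq_zero.1 h6
  rw [← h5]
  exact h2.congr (fun r hr => hu.vorticity_eq (hJ hr) _) (hu.vorticity_eq (hJ ht) _)

theorem IsEulerSolution.contDiff_vorticity (hu : IsEulerSolution u p T) (ht : t ∈ Ico 0 T) :
    ContDiff ℝ 1 (vorticity u t) := by
  rw [← contDiffOn_univ]
  exact hu.contDiffOn_vorticity.comp (contDiff_const.prodMk contDiff_id).contDiffOn
    (mapsTo_slab ht univ)

/-- The vorticity is divergence free. -/
theorem IsEulerSolution.divergence_vorticity (hu : IsEulerSolution u p T) (ht : t ∈ Ico 0 T)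
    (x : E3) : divergence (vorticity u t) x = 0 := by
  have h1 := (hasFDerivAt_slice ht (hu.hasFDerivWithinAt_velD ht x)).clm_comp
    (hasFDerivAt_const (ContinuousLinearMap.inr ℝ ℝ E3) x)
  have h2 := curlL.hasFDerivAt.comp x h1
  have h3 := h2.congr_of_eventuallyEq
    (Eventually.of_forall fun y => hu.vorticity_eq ht y : vorticity u t =ᶠ[𝓝 x] _)
  have hs : ∀ i j : Fin 3, velDD u T (t, x) (0, EuclideanSpace.single i 1)
      (0, EuclideanSpace.single j 1) = velDD u T (t, x) (0, EuclideanSpace.single j 1)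
      (0, EuclideanSpace.single i 1) := fun i j => hu.velD_symm ht x _ _
  simp only [divergence, partialD, h3.fderiv, Fin.sum_univ_three]
  simp [curlL_apply]
  rw [hs 1 0, hs 2 0, hs 2 1]
  ring

end Euler

/-! ### Trajectories near a given one, and transport of vortex lines. -/

section Flow

variable {u : ℝ → E3 → E3} {p : ℝ → E3 → ℝ} {T T₀ c : ℝ}

theorem Icc_subset_Ico_of_lt (hT₀ : 0 ≤ T₀) (hc : c < T) : Icc T₀ c ⊆ Ico 0 T :=
  fun _ hr => ⟨hT₀.trans hr.1, hr.2.trans_lt hc⟩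

/-- Taylor expansion of the velocity in space, uniform along a curve. -/
theorem IsEulerSolution.exists_taylor (hu : IsEulerSolution u p T) (hT₀ : 0 ≤ T₀) (hc : c < T)
    {y : ℝ → E3} (hy : ContinuousOn y (Icc T₀ c)) {ε : ℝ} (hε : 0 < ε) :
    ∃ δ > 0, ∀ r ∈ Icc T₀ c, ∀ z : E3, ‖z - y r‖ ≤ δ →
      ‖u r z - u r (y r) - fderiv ℝ (u r) (y r) (z - y r)‖ ≤ ε * ‖z - y r‖ := by
  -- Centring at the curve makes the displacement from `y r` the small variable and the time the
  -- compact one, so a single δ serves all times.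
  have hcont : ContinuousOn (fun q : E3 × ℝ => fderiv ℝ (u q.2) (y q.2 + q.1))
      (univ ×ˢ Icc T₀ c) := by
    refine hu.contDiffOn_spatial.continuousOn.comp (f := fun q : E3 × ℝ => (q.2, y q.2 + q.1))
      (continuousOn_snd.prodMk ((hy.comp continuousOn_snd fun q hq => hq.2).add
        continuousOn_fst)) fun q hq => ⟨Icc_subset_Ico_of_lt hT₀ hc hq.2, mem_univ _⟩
  obtain ⟨v, hv, hvK⟩ := isCompact_Icc.mem_uniformity_of_prod
    (f := fun (w : E3) (r : ℝ) => fderiv ℝ (u r) (y r + w)) (s := univ) (q := 0) hcont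
    (mem_univ _) (Metric.dist_mem_uniformity hε)
  rw [nhdsWithin_univ] at hv
  obtain ⟨δ, hδ, hsub⟩ := Metric.nhds_basis_closedBall.mem_iff.1 hv
  refine ⟨δ, hδ, fun r hr z hz => ?_⟩
  have hr' := Icc_subset_Ico_of_lt hT₀ hc hr
  refine (convex_closedBall (y r) δ).norm_image_sub_le_of_norm_hasFDerivWithin_le'
    (f := u r) (f' := fderiv ℝ (u r))
    (fun w hw => (hu.hasFDerivAt hr' w).differentiableAt.hasFDerivAt.hasFDerivWithinAt)
    (fun w hw => ?_) (Metric.mem_closedBall_self hδ.le) (by simpa [dist_eq_norm] using hz)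
  have h1 : dist (fderiv ℝ (u r) (y r + (w - y r))) (fderiv ℝ (u r) (y r + 0)) < ε :=
    hvK (w - y r) (hsub (by simpa [dist_eq_norm] using hw)) r hr
  rw [add_sub_cancel, add_zero] at h1
  rw [← dist_eq_norm]
  exact h1.le

theorem IsEulerSolution.exists_bound_fderiv (hu : IsEulerSolution u p T) (hT₀ : 0 ≤ T₀)
    (hc : c < T) {y : ℝ → E3} (hy : ContinuousOn y (Icc T₀ c)) :
    ∃ K : ℝ, 0 ≤ K ∧ ∀ r ∈ Icc T₀ c, ‖fderiv ℝ (u r) (y r)‖ ≤ K := by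
  obtain ⟨K, hK⟩ := isCompact_Icc.exists_bound_of_continuousOn
    (hu.contDiffOn_spatial.continuousOn.comp (f := fun r => (r, y r))
      (continuousOn_id.prodMk hy)
      fun r hr => (⟨Icc_subset_Ico_of_lt hT₀ hc hr, mem_univ _⟩ : _ ∈ Ico 0 T ×ˢ univ))
  exact ⟨max K 0, le_max_right _ _, fun r hr => (hK r hr).trans (le_max_left _ _)⟩

/-- Lipschitz dependence of particle trajectories on the starting point. -/
theorem IsEulerSolution.exists_trajectory_lipschitz (hu : IsEulerSolution u p T) (hT₀ : 0 ≤ T₀)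
    (hc : c < T) {y : ℝ → E3}
    (hy : ∀ r ∈ Icc T₀ c, HasDerivWithinAt y (u r (y r)) (Icc T₀ c) r) :
    ∃ C > 0, ∃ δ > 0, ∀ z : ℝ → E3,
      (∀ r ∈ Icc T₀ c, HasDerivWithinAt z (u r (z r)) (Icc T₀ c) r) →
      ∀ η, 0 < η → η ≤ δ → ‖z T₀ - y T₀‖ ≤ η → ∀ r ∈ Icc T₀ c, ‖z r - y r‖ ≤ C * η := by
  have hyc : ContinuousOn y (Icc T₀ c) := fun r hr => (hy r hr).continuousWithinAt
  obtain ⟨δ, hδ, hT⟩ := hu.exists_taylor hT₀ hc hyc one_pos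
  obtain ⟨K, hK0, hK⟩ := hu.exists_bound_fderiv hT₀ hc hyc
  have hexp : ∀ r ∈ Icc T₀ c, Real.exp ((K + 2) * (r - T₀)) ≤ Real.exp ((K + 2) * (c - T₀)) :=
    fun r hr => by
      refine Real.exp_le_exp.2 (mul_le_mul_of_nonneg_left ?_ (by linarith))
      linarith [hr.2]
  -- The rate K + 2 consists of the bound K on ∇u along y, 1 for the Taylor error, and 1 for
  -- strictness. The choice of δ keeps the barrier inside the ball where the Taylor estimate holds,
  -- so no global Lipschitz bound on u is needed.
  refine ⟨Real.exp ((K + 2) * (c - T₀)), Real.exp_pos _, δ / Real.exp ((K + 2) * (c - T₀)),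
    by positivity, fun z hz η hη hηδ h0 r hr => ?_⟩
  rw [le_div_iff₀ (Real.exp_pos _)] at hηδ
  have key := norm_le_mul_exp_of_deriv (f := fun r => z r - y r) (K := K + 2)
    (fun r hr => (hz r hr).sub (hy r hr)) h0 (fun r hr hbd => ?_) r hr
  · refine key.trans ?_
    rw [mul_comm]
    exact mul_le_mul_of_nonneg_right (hexp r hr) hη.le
  · have hr' := Ico_subset_Icc_self hr
    have hle : ‖z r - y r‖ ≤ δ := by
      rw [hbd]
      exact (mul_le_mul_of_nonneg_left (hexp r hr') hη.le).trans hηδ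
    have hpos : 0 < ‖z r - y r‖ := by rw [hbd]; positivity
    have h1 := hT r hr' (z r) hle
    have h2 : ‖fderiv ℝ (u r) (y r) (z r - y r)‖ ≤ K * ‖z r - y r‖ :=
      (ContinuousLinearMap.le_opNorm _ _).trans (by gcongr; exact hK r hr')
    have h3 : ‖u r (z r) - u r (y r)‖ ≤ ‖u r (z r) - u r (y r) -
        fderiv ℝ (u r) (y r) (z r - y r)‖ + ‖fderiv ℝ (u r) (y r) (z r - y r)‖ := by
      simpa using norm_add_le (u r (z r) - u r (y r) -
        fderiv ℝ (u r) (y r) (z r - y r)) (fderiv ℝ (u r) (y r) (z r - y r))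
    nlinarith

/-- Vorticity does not vanish along a trajectory on which it does not vanish initially. -/
theorem IsEulerSolution.vorticity_ne_zero (hu : IsEulerSolution u p T) (hT₀ : 0 ≤ T₀)
    (hc : c < T) {y : ℝ → E3}
    (hy : ∀ r ∈ Icc T₀ c, HasDerivWithinAt y (u r (y r)) (Icc T₀ c) r)
    (h0 : vorticity u T₀ (y T₀) ≠ 0) {r : ℝ} (hr : r ∈ Icc T₀ c) : vorticity u r (y r) ≠ 0 := by
  intro hzero
  have hyc : ContinuousOn y (Icc T₀ c) := fun r hr => (hy r hr).continuousWithinAt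
  obtain ⟨K, hK0, hK⟩ := hu.exists_bound_fderiv hT₀ hc hyc
  have hsub : Icc T₀ r ⊆ Icc T₀ c := Icc_subset_Icc_right hr.2
  have hω : ∀ s ∈ Icc T₀ r, HasDerivWithinAt (fun r => vorticity u r (y r))
      (fderiv ℝ (u s) (y s) (vorticity u s (y s))) (Icc T₀ r) s := fun s hs =>
    hu.hasDerivWithinAt_vorticity (hsub.trans (Icc_subset_Ico_of_lt hT₀ hc)) hs
      ((hy s (hsub hs)).mono hsub)
  -- ω solves a linear equation along the trajectory; backward uniqueness from a zero at time r
  -- would make it vanish at T₀.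
  have huniq := ODE_solution_unique_of_mem_Icc_left (a := T₀) (b := r) (K := ⟨K, hK0⟩)
    (f := fun r => vorticity u r (y r)) (g := fun _ => 0) (s := fun _ => univ)
    (v := fun s w => fderiv ℝ (u s) (y s) w)
    (fun s hs => ((fderiv ℝ (u s) (y s)).lipschitz.weaken
      (hK s (hsub (Ioc_subset_Icc_self hs)))).lipschitzOnWith)
    (fun s hs => (hω s hs).continuousWithinAt)
    (fun s hs => (hω s (Ioc_subset_Icc_self hs)).mono_of_mem_nhdsWithin
      (Icc_mem_nhdsLE_of_mem hs))
    (fun _ _ => mem_univ _) continuousOn_const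
    (fun s hs => by simpa using hasDerivWithinAt_const s (Iic s) (0 : E3))
    (fun _ _ => mem_univ _) hzero
  exact h0 (huniq ⟨le_rfl, hr.1⟩)

variable {I : Set ℝ} {γ : ℝ → E3} {X : ℝ → E3 → E3}

theorem IsParticleFlow.hasDerivWithinAt_Icc {A : Set E3} (hX : IsParticleFlow u T₀ T A X)
    (hc : c < T) {a : E3} (ha : a ∈ A) :
    ∀ r ∈ Icc T₀ c, HasDerivWithinAt (fun r => X r a) (u r (X r a)) (Icc T₀ c) r := fun r hr =>
  ((hX a ha).2 r ⟨hr.1, hr.2.trans_lt hc⟩).mono fun _ hs => ⟨hs.1, hs.2.trans_lt hc⟩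

/-- The flow along a vortex line is jointly continuous. -/
theorem IsEulerSolution.continuousOn_flow (hu : IsEulerSolution u p T) (hT₀ : 0 ≤ T₀)
    (hc : c < T) (hγ : IsVortexLine u T₀ I γ) (hX : IsParticleFlow u T₀ T (γ '' I) X) :
    ContinuousOn (fun q : ℝ × ℝ => X q.1 (γ q.2)) (Icc T₀ c ×ˢ I) := by
  rintro ⟨r, β⟩ ⟨hr, hβ⟩
  have hy := hX.hasDerivWithinAt_Icc hc (mem_image_of_mem γ hβ)
  obtain ⟨C, hC, δ, hδ, hLip⟩ := hu.exists_trajectory_lipschitz hT₀ hc hy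
  refine Metric.continuousWithinAt_iff'.2 fun ε hε => ?_
  have hη : 0 < min δ (ε / (3 * C)) := lt_min hδ (by positivity)
  have h1 : ∀ᶠ β' in 𝓝[I] β, ‖γ β' - γ β‖ ≤ min δ (ε / (3 * C)) := by
    filter_upwards [(hγ.2 β hβ).2.continuousWithinAt.eventually
      (Metric.ball_mem_nhds (γ β) hη)] with β' hβ'
    rw [← dist_eq_norm]; exact le_of_lt hβ'
  have h2 : ∀ᶠ r' in 𝓝[Icc T₀ c] r, dist (X r' (γ β)) (X r (γ β)) < ε / 2 :=
    (hy r hr).continuousWithinAt.eventually (Metric.ball_mem_nhds _ (half_pos hε))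
  rw [nhdsWithin_prod_eq]
  have h3 : ∀ᶠ β' in 𝓝[I] β, β' ∈ I := self_mem_nhdsWithin
  have h4 : ∀ᶠ r' in 𝓝[Icc T₀ c] r, r' ∈ Icc T₀ c := self_mem_nhdsWithin
  filter_upwards [(h2.and h4).prod_mk (h1.and h3)] with q hq
  obtain ⟨⟨ha, hb⟩, hd, he⟩ := hq
  have h5 := hLip (fun r => X r (γ q.2)) (hX.hasDerivWithinAt_Icc hc (mem_image_of_mem γ he))
    _ hη (min_le_left _ _)
    (by rw [(hX _ (mem_image_of_mem γ he)).1, (hX _ (mem_image_of_mem γ hβ)).1]; exact hd) q.1 hb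
  have h6 : C * min δ (ε / (3 * C)) ≤ ε / 3 := by
    calc _ ≤ C * (ε / (3 * C)) := by gcongr; exact min_le_right _ _
      _ = ε / 3 := by field_simp
  rw [← dist_eq_norm] at h5
  calc dist (X q.1 (γ q.2)) (X r (γ β))
      ≤ dist (X q.1 (γ q.2)) (X q.1 (γ β)) + dist (X q.1 (γ β)) (X r (γ β)) :=
        dist_triangle _ _ _
    _ < ε := by linarith

/-- Vortex lines move with the flow: the derivative of the flow along a vortex line is the
vorticity divided by its initial strength. -/
theorem IsEulerSolution.hasDerivWithinAt_flow (hu : IsEulerSolution u p T) (hT₀ : 0 ≤ T₀)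
    (hγ : IsVortexLine u T₀ I γ) (hX : IsParticleFlow u T₀ T (γ '' I) X) {t : ℝ}
    (ht : t ∈ Ico T₀ T) {β : ℝ} (hβ : β ∈ I) :
    HasDerivWithinAt (fun β => X t (γ β))
      (‖vorticity u T₀ (γ β)‖⁻¹ • vorticity u t (X t (γ β))) I β := by
  -- `V`, a constant multiple of ω along the trajectory, solves the linearised equation V' = ∇u V
  -- with V(T₀) = γ'(β). It remains to show that X(γ(β')) − X(γ(β)) − (β' − β)V, which is o(β' − β)
  -- at T₀, stays so up to time `t`.
  set V : ℝ → E3 := fun r => ‖vorticity u T₀ (γ β)‖⁻¹ • vorticity u r (X r (γ β)) with hV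
  have hX0 : ∀ β ∈ I, X T₀ (γ β) = γ β := fun β hβ => (hX _ (mem_image_of_mem γ hβ)).1
  have hy := hX.hasDerivWithinAt_Icc ht.2 (mem_image_of_mem γ hβ)
  have hyc : ContinuousOn (fun r => X r (γ β)) (Icc T₀ t) :=
    fun r hr => (hy r hr).continuousWithinAt
  have hV' : ∀ r ∈ Icc T₀ t, HasDerivWithinAt V (fderiv ℝ (u r) (X r (γ β)) (V r))
      (Icc T₀ t) r := fun r hr => by
    have := (hu.hasDerivWithinAt_vorticity (Icc_subset_Ico_of_lt hT₀ ht.2) hr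
      (hy r hr)).const_smul ‖vorticity u T₀ (γ β)‖⁻¹
    exact this.congr_deriv (by rw [hV, map_smul])
  have hV0 : V T₀ = xi u T₀ (γ β) := by simp only [hV, hX0 β hβ, xi]
  obtain ⟨C, hC, δ₁, hδ₁, hLip⟩ := hu.exists_trajectory_lipschitz hT₀ ht.2 hy
  obtain ⟨K, hK0, hK⟩ := hu.exists_bound_fderiv hT₀ ht.2 hyc
  have hγ' := hasDerivWithinAt_iff_isLittleO.1 (hγ.2 β hβ).2
  rw [← hV0] at hγ'
  refine hasDerivWithinAt_iff_isLittleO.2 (isLittleO_iff.2 fun ε hε => ?_)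
  set M : ℝ := ‖V T₀‖ + 1 with hM
  have hMpos : 0 < M := by positivity
  -- The initial tolerance is ε divided by the largest growth factor of the barrier.
  set ε₁ : ℝ := ε / Real.exp ((K + 1) * (t - T₀)) with hε₁
  have hε₁pos : 0 < ε₁ := by positivity
  -- Trajectories separate by at most CM|β' − β|, so this tolerance makes the Taylor error at most
  -- ε₁|β' − β|/2.
  obtain ⟨δ₂, hδ₂, hT⟩ := hu.exists_taylor hT₀ ht.2 hyc
    (show 0 < ε₁ / (2 * C * M) by positivity)
  have hlim : Tendsto (fun β' => |β' - β|) (𝓝[I] β) (𝓝 0) := by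
    have : Continuous fun β' : ℝ => |β' - β| := by fun_prop
    simpa using (this.tendsto β).mono_left nhdsWithin_le_nhds
  have h1 := hlim.eventually (ge_mem_nhds (show 0 < δ₁ / M by positivity))
  have h2 := hlim.eventually (ge_mem_nhds (show 0 < δ₂ / (C * M) by positivity))
  filter_upwards [h1, h2, isLittleO_iff.1 hγ' hε₁pos, isLittleO_iff.1 hγ' one_pos,
    self_mem_nhdsWithin] with β' hb1 hb2 hb3 hb4 hβ'
  rcases eq_or_ne β' β with rfl | hne
  · simp
  have hΔ : 0 < |β' - β| := abs_pos.2 (sub_ne_zero.2 hne)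
  have hz := hX.hasDerivWithinAt_Icc ht.2 (mem_image_of_mem γ hβ')
  rw [le_div_iff₀ (by positivity)] at hb1 hb2
  rw [Real.norm_eq_abs] at hb3 hb4 ⊢
  have hγM : ‖γ β' - γ β‖ ≤ M * |β' - β| := by
    have h3 : ‖γ β' - γ β‖ ≤ ‖γ β' - γ β - (β' - β) • V T₀‖ + ‖(β' - β) • V T₀‖ := by
      simpa using norm_add_le (γ β' - γ β - (β' - β) • V T₀) ((β' - β) • V T₀)
    rw [norm_smul, Real.norm_eq_abs] at h3
    rw [hM]; linarith
  have hZ : ∀ r ∈ Icc T₀ t, ‖X r (γ β') - X r (γ β)‖ ≤ C * (M * |β' - β|) :=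
    hLip _ hz (M * |β' - β|) (by positivity) (by linarith)
      (by rw [hX0 _ hβ', hX0 _ hβ]; exact hγM)
  have key := norm_le_mul_exp_of_deriv (a := T₀) (c := t) (K := K + 1) (η := ε₁ * |β' - β|)
    (f := fun r => X r (γ β') - X r (γ β) - (β' - β) • V r)
    (fun r hr => ((hz r hr).sub (hy r hr)).sub ((hV' r hr).const_smul (β' - β)))
    (by simpa only [hX0 _ hβ', hX0 _ hβ] using hb3) (fun r hr hbd => ?_) t ⟨ht.1, le_rfl⟩
  · refine key.trans (le_of_eq ?_)
    rw [hε₁]; field_simp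
  · have hr' := Ico_subset_Icc_self hr
    set W : E3 := X r (γ β') - X r (γ β) - (β' - β) • V r with hW
    -- Where `W` meets the barrier it is at least ε₁|β' − β|, so the Taylor error is at most ‖W‖/2
    -- and the rate K + 1 is strictly sufficient.
    have hWlow : ε₁ * |β' - β| ≤ ‖W‖ := by
      have hexp : 1 ≤ Real.exp ((K + 1) * (r - T₀)) :=
        Real.one_le_exp (mul_nonneg (by linarith) (by linarith [hr.1]))
      rw [hbd]
      exact le_mul_of_one_le_right (by positivity) hexp
    have h5 := hT r hr' (X r (γ β')) ((hZ r hr').trans (by linarith))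
    have h6 : ‖fderiv ℝ (u r) (X r (γ β)) W‖ ≤ K * ‖W‖ :=
      (ContinuousLinearMap.le_opNorm _ _).trans (by gcongr; exact hK r hr')
    have h7 : ε₁ / (2 * C * M) * ‖X r (γ β') - X r (γ β)‖ ≤ ε₁ * |β' - β| / 2 := by
      calc _ ≤ ε₁ / (2 * C * M) * (C * (M * |β' - β|)) := by gcongr; exact hZ r hr'
        _ = ε₁ * |β' - β| / 2 := by field_simp
    have h8 : u r (X r (γ β')) - u r (X r (γ β)) -
        (β' - β) • fderiv ℝ (u r) (X r (γ β)) (V r) =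
        (u r (X r (γ β')) - u r (X r (γ β)) -
          fderiv ℝ (u r) (X r (γ β)) (X r (γ β') - X r (γ β))) +
          fderiv ℝ (u r) (X r (γ β)) W := by
      have h9 : fderiv ℝ (u r) (X r (γ β)) W =
          fderiv ℝ (u r) (X r (γ β)) (X r (γ β') - X r (γ β)) -
            (β' - β) • fderiv ℝ (u r) (X r (γ β)) (V r) := by
        rw [← map_smul, ← map_sub]
      rw [h9]; abel
    have h9 : 0 < ε₁ * |β' - β| := by positivity
    rw [h8]
    refine (norm_add_le _ _).trans_lt ?_
    nlinarith

end Flow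

/-! ### Identities along a vortex line at a fixed time. -/

section Spatial

variable {u : ℝ → E3 → E3} {p : ℝ → E3 → ℝ} {T t : ℝ} {x : E3}

/-- The stretching rate `ξ · ∇u · ξ`. -/
noncomputable def stretching (u : ℝ → E3 → E3) (t : ℝ) (x : E3) : ℝ :=
  inner ℝ (fderiv ℝ (u t) x (xi u t x)) (xi u t x)

theorem norm_xi (hx : vorticity u t x ≠ 0) : ‖xi u t x‖ = 1 := by
  rw [xi, norm_smul, norm_inv, norm_norm, inv_mul_cancel₀ (norm_ne_zero_iff.2 hx)]

theorem norm_smul_xi (hx : vorticity u t x ≠ 0) :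
    ‖vorticity u t x‖ • xi u t x = vorticity u t x := by
  rw [xi, smul_smul, mul_inv_cancel₀ (norm_ne_zero_iff.2 hx), one_smul]

theorem IsEulerSolution.contDiffAt_norm_vorticity (hu : IsEulerSolution u p T)
    (ht : t ∈ Ico 0 T) (hx : vorticity u t x ≠ 0) :
    ContDiffAt ℝ 1 (fun y => ‖vorticity u t y‖) x :=
  (hu.contDiff_vorticity ht).contDiffAt.norm ℝ hx

theorem IsEulerSolution.contDiffAt_xi (hu : IsEulerSolution u p T) (ht : t ∈ Ico 0 T)
    (hx : vorticity u t x ≠ 0) : ContDiffAt ℝ 1 (xi u t) x :=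
  ((hu.contDiffAt_norm_vorticity ht hx).inv (norm_ne_zero_iff.2 hx)).smul
    (hu.contDiff_vorticity ht).contDiffAt

theorem IsEulerSolution.continuousAt_fderiv_xi (hu : IsEulerSolution u p T) (ht : t ∈ Ico 0 T)
    (hx : vorticity u t x ≠ 0) : ContinuousAt (fderiv ℝ (xi u t)) x :=
  (hu.contDiffAt_xi ht hx).continuousAt_fderiv (by norm_num)

theorem IsEulerSolution.continuousAt_tau (hu : IsEulerSolution u p T) (ht : t ∈ Ico 0 T)
    (hx : vorticity u t x ≠ 0) : ContinuousAt (tau u t) x := by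
  have h := hu.continuousAt_fderiv_xi ht hx
  have h2 : ∀ i : Fin 3, ContinuousAt
      (fun y => (fderiv ℝ (xi u t) y (EuclideanSpace.single i 1)) i) x := fun i =>
    (EuclideanSpace.proj (𝕜 := ℝ) i).continuous.continuousAt.comp
      (h.clm_apply continuousAt_const)
  exact (((h2 0).add (h2 1)).add (h2 2)).congr
    (Eventually.of_forall fun y => (Fin.sum_univ_three fun i => partialD (xi u t) y i i).symm)

theorem IsEulerSolution.continuousAt_curvatureVector (hu : IsEulerSolution u p T)
    (ht : t ∈ Ico 0 T) (hx : vorticity u t x ≠ 0) : ContinuousAt (curvatureVector u t) x :=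
  (hu.continuousAt_fderiv_xi ht hx).clm_apply (hu.contDiffAt_xi ht hx).continuousAt

theorem IsEulerSolution.continuousAt_uXi (hu : IsEulerSolution u p T)
    (ht : t ∈ Ico 0 T) (hx : vorticity u t x ≠ 0) : ContinuousAt (uXi u t) x :=
  (hu.hasFDerivAt ht x).continuousAt.inner (𝕜 := ℝ) (hu.contDiffAt_xi ht hx).continuousAt

/-- The normal ξ^⊥ may jump where κ = 0, but its product with κ is the curvature vector, which is
continuous wherever ω ≠ 0. Working with the product makes the integrands continuous. -/
theorem kappa_mul_uXiPerp (u : ℝ → E3 → E3) (t : ℝ) (x : E3) :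
    kappa u t x * uXiPerp u t x = inner ℝ (u t x) (curvatureVector u t x) := by
  rw [kappa, uXiPerp, xiPerp, inner_smul_right]
  rcases eq_or_ne (curvatureVector u t x) 0 with h | h
  · simp [h]
  · rw [← mul_assoc, mul_inv_cancel₀ (norm_ne_zero_iff.2 h), one_mul]

theorem IsEulerSolution.continuousAt_kappa_mul_uXiPerp (hu : IsEulerSolution u p T)
    (ht : t ∈ Ico 0 T) (hx : vorticity u t x ≠ 0) :
    ContinuousAt (fun y => kappa u t y * uXiPerp u t y) x := by
  simp only [kappa_mul_uXiPerp]
  exact (hu.hasFDerivAt ht x).continuousAt.inner (𝕜 := ℝ) (hu.continuousAt_curvatureVector ht hx)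

theorem IsEulerSolution.continuousAt_stretching (hu : IsEulerSolution u p T)
    (ht : t ∈ Ico 0 T) (hx : vorticity u t x ≠ 0) : ContinuousAt (stretching u t) x := by
  have h1 : ContinuousAt (fderiv ℝ (u t)) x := by
    have := hu.contDiffOn_spatial.continuousOn.comp (f := fun y : E3 => (t, y))
      (continuous_const.prodMk continuous_id).continuousOn (mapsTo_slab ht univ)
    exact this.continuousAt univ_mem
  have h2 := (hu.contDiffAt_xi ht hx).continuousAt
  exact (h1.clm_apply h2).inner (𝕜 := ℝ) h2

/-- Since `|ω| ξ` is divergence free, `ξ · ∇|ω| = - τ |ω|`. -/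
theorem IsEulerSolution.fderiv_norm_vorticity_xi (hu : IsEulerSolution u p T)
    (ht : t ∈ Ico 0 T) (hx : vorticity u t x ≠ 0) :
    fderiv ℝ (fun y => ‖vorticity u t y‖) x (xi u t x) = - (tau u t x * ‖vorticity u t x‖) := by
  have hN := ((hu.contDiffAt_norm_vorticity ht hx).differentiableAt (by norm_num)).hasFDerivAt
  have hξ := ((hu.contDiffAt_xi ht hx).differentiableAt (by norm_num)).hasFDerivAt
  have hev : vorticity u t =ᶠ[𝓝 x] fun y => ‖vorticity u t y‖ • xi u t y := by
    filter_upwards [(hu.contDiff_vorticity ht).continuous.continuousAt.eventually_ne hx] with y hy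
    exact (norm_smul_xi hy).symm
  have hω := (hN.smul hξ).congr_of_eventuallyEq hev
  have hdiv := hu.divergence_vorticity ht x
  have hsum : fderiv ℝ (fun y => ‖vorticity u t y‖) x (xi u t x) =
      ∑ i, xi u t x i * fderiv ℝ (fun y => ‖vorticity u t y‖) x (EuclideanSpace.single i 1) := by
    conv_lhs => rw [eq_sum_single (xi u t x)]
    simp [Fin.sum_univ_three]
  simp only [divergence, partialD, hω.fderiv, Fin.sum_univ_three] at hdiv
  rw [hsum, tau, divergence]
  simp only [partialD, Fin.sum_univ_three]
  simp only [add_apply, smul_apply, ContinuousLinearMap.smulRight_apply,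
    PiLp.add_apply, PiLp.smul_apply, smul_eq_mul] at hdiv
  linarith

variable {c : ℝ → E3} {I : Set ℝ} {s : ℝ}

theorem IsEulerSolution.hasDerivWithinAt_norm_vorticity_line (hu : IsEulerSolution u p T)
    (ht : t ∈ Ico 0 T) (hc : IsVortexLine u t I c) (hs : s ∈ I) :
    HasDerivWithinAt (fun s => ‖vorticity u t (c s)‖)
      (- (tau u t (c s) * ‖vorticity u t (c s)‖)) I s := by
  obtain ⟨h0, h1⟩ := hc.2 s hs
  have hN := ((hu.contDiffAt_norm_vorticity ht h0).differentiableAt (by norm_num)).hasFDerivAt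
  rw [← hu.fderiv_norm_vorticity_xi ht h0]
  exact hN.comp_hasDerivWithinAt s h1

/-- By the product rule with c' = ξ, differentiating u gives the stretching rate and differentiating
ξ gives u·(ξ·∇ξ). Integration of this identity is what eliminates the stretching rate. -/
theorem IsEulerSolution.hasDerivWithinAt_uXi_line (hu : IsEulerSolution u p T)
    (ht : t ∈ Ico 0 T) (hc : IsVortexLine u t I c) (hs : s ∈ I) :
    HasDerivWithinAt (fun s => uXi u t (c s))
      (stretching u t (c s) + kappa u t (c s) * uXiPerp u t (c s)) I s := by
  obtain ⟨h0, h1⟩ := hc.2 s hs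
  have hξ := ((hu.contDiffAt_xi ht h0).differentiableAt (by norm_num)).hasFDerivAt
  have h2 := (hu.hasFDerivAt ht (c s)).comp_hasDerivWithinAt s h1
  have h3 := hξ.comp_hasDerivWithinAt s h1
  refine (h2.inner ℝ h3).congr_deriv ?_
  rw [kappa_mul_uXiPerp, stretching, hu.fderiv_eq ht, add_comm]
  rfl

/-- Continuity along a vortex line of a function that is continuous off the zeros of the
vorticity. -/
theorem IsVortexLine.continuousOn_comp {F : Type*} [TopologicalSpace F] {g : E3 → F}
    (hc : IsVortexLine u t I c)
    (hg : ∀ y, vorticity u t y ≠ 0 → ContinuousAt g y) : ContinuousOn (fun s => g (c s)) I :=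
  fun s hs => (hg _ (hc.2 s hs).1).comp_continuousWithinAt (hc.2 s hs).2.continuousWithinAt

theorem IsVortexLine.continuousOn_norm_vorticity (hc : IsVortexLine u t I c)
    (hu : IsEulerSolution u p T) (ht : t ∈ Ico 0 T) :
    ContinuousOn (fun s => ‖vorticity u t (c s)‖) I :=
  hc.continuousOn_comp (g := fun y => ‖vorticity u t y‖)
    fun _ _ => (hu.contDiff_vorticity ht).continuous.norm.continuousAt

theorem IsVortexLine.continuousOn_tau_integrand (hc : IsVortexLine u t I c)
    (hu : IsEulerSolution u p T) (ht : t ∈ Ico 0 T) :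
    ContinuousOn (fun s => 2 * tau u t (c s) * ‖vorticity u t (c s)‖ * uXi u t (c s)) I :=
  (((hc.continuousOn_comp fun _ => hu.continuousAt_tau ht).const_smul (2 : ℝ)).mul
    (hc.continuousOn_norm_vorticity hu ht)).mul
    (hc.continuousOn_comp fun _ => hu.continuousAt_uXi ht)

theorem IsVortexLine.continuousOn_kappa_integrand (hc : IsVortexLine u t I c)
    (hu : IsEulerSolution u p T) (ht : t ∈ Ico 0 T) :
    ContinuousOn (fun s => kappa u t (c s) * ‖vorticity u t (c s)‖ * uXiPerp u t (c s)) I :=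
  ((hc.continuousOn_comp fun _ => hu.continuousAt_kappa_mul_uXiPerp ht).mul
    (hc.continuousOn_norm_vorticity hu ht)).congr fun _ _ => mul_right_comm _ _ _

/-- The integral of the stretching rate along a vortex line segment. -/
theorem IsEulerSolution.integral_stretching (hu : IsEulerSolution u p T) (ht : t ∈ Ico 0 T)
    {ℓ : ℝ} (hℓ : 0 ≤ ℓ) (hc : IsVortexLine u t (Icc 0 ℓ) c) :
    ∫ s in (0 : ℝ)..ℓ, stretching u t (c s) =
      uXi u t (c ℓ) - uXi u t (c 0) -
        ∫ s in (0 : ℝ)..ℓ, kappa u t (c s) * uXiPerp u t (c s) := by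
  have h1 := hc.continuousOn_comp fun y => hu.continuousAt_stretching ht
  have h2 := hc.continuousOn_comp fun y => hu.continuousAt_kappa_mul_uXiPerp ht
  have hd := fun s hs => hu.hasDerivWithinAt_uXi_line (s := s) ht hc hs
  have i1 := h1.intervalIntegrable_of_Icc (μ := volume) hℓ
  have i2 := h2.intervalIntegrable_of_Icc (μ := volume) hℓ
  have h3 := intervalIntegral.integral_eq_sub_of_hasDerivAt_of_le hℓ
    (fun s hs => (hd s hs).continuousWithinAt)
    (fun s hs => (hd s (Ioo_subset_Icc_self hs)).hasDerivAt (Icc_mem_nhds hs.1 hs.2))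
    (i1.add i2)
  rw [intervalIntegral.integral_add i1 i2] at h3
  linarith

/-- The integral of the stretching rate times the vorticity along a vortex line segment. -/
theorem IsEulerSolution.integral_stretching_mul (hu : IsEulerSolution u p T)
    (ht : t ∈ Ico 0 T) {ℓ : ℝ} (hℓ : 0 ≤ ℓ) (hc : IsVortexLine u t (Icc 0 ℓ) c) :
    ∫ s in (0 : ℝ)..ℓ, 2 * (stretching u t (c s) * ‖vorticity u t (c s)‖) =
      2 * (uXi u t (c ℓ) * ‖vorticity u t (c ℓ)‖ - uXi u t (c 0) * ‖vorticity u t (c 0)‖)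
      + (∫ s in (0 : ℝ)..ℓ, 2 * tau u t (c s) * ‖vorticity u t (c s)‖ * uXi u t (c s))
      - 2 * ∫ s in (0 : ℝ)..ℓ, kappa u t (c s) * ‖vorticity u t (c s)‖ * uXiPerp u t (c s) := by
  have h1 := hc.continuousOn_comp fun y => hu.continuousAt_stretching ht
  have h2 := hc.continuousOn_norm_vorticity hu ht
  -- The primitive is 2(u·ξ)|ω|: the derivative of u·ξ gives the stretching and κ terms, that of |ω|
  -- the τ term.
  have hd : ∀ s ∈ Icc 0 ℓ, HasDerivWithinAt
      (fun s => 2 * (uXi u t (c s) * ‖vorticity u t (c s)‖))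
      (2 * (stretching u t (c s) * ‖vorticity u t (c s)‖) +
        2 * (kappa u t (c s) * ‖vorticity u t (c s)‖ * uXiPerp u t (c s)) -
        2 * tau u t (c s) * ‖vorticity u t (c s)‖ * uXi u t (c s)) (Icc 0 ℓ) s := fun s hs =>
    (((hu.hasDerivWithinAt_uXi_line ht hc hs).mul
      (hu.hasDerivWithinAt_norm_vorticity_line ht hc hs)).const_mul 2).congr_deriv (by ring)
  have i1 : IntervalIntegrable (fun s => 2 * (stretching u t (c s) * ‖vorticity u t (c s)‖))
      volume 0 ℓ := ((h1.mul h2).const_smul (2 : ℝ)).intervalIntegrable_of_Icc hℓ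
  have i2 := (hc.continuousOn_tau_integrand hu ht).intervalIntegrable_of_Icc (μ := volume) hℓ
  have i3 := ((hc.continuousOn_kappa_integrand hu ht).intervalIntegrable_of_Icc
    (μ := volume) hℓ).const_mul 2
  have h6 := intervalIntegral.integral_eq_sub_of_hasDerivAt_of_le hℓ
    (fun s hs => (hd s hs).continuousWithinAt)
    (fun s hs => (hd s (Ioo_subset_Icc_self hs)).hasDerivAt (Icc_mem_nhds hs.1 hs.2))
    ((i1.add i3).sub i2)
  rw [intervalIntegral.integral_sub (i1.add i3) i2, intervalIntegral.integral_add i1 i3,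
    intervalIntegral.integral_const_mul 2 (fun s => kappa u t (c s) * _ * uXiPerp u t (c s))] at h6
  linarith

end Spatial

/-! ### Evolution of length and total vorticity through labels. -/

section Transport

variable {u : ℝ → E3 → E3} {p : ℝ → E3 → ℝ} {T₀ T t : ℝ}

theorem inner_vorticity_xi (u : ℝ → E3 → E3) (t : ℝ) (x : E3) :
    inner ℝ (vorticity u t x) (xi u t x) = ‖vorticity u t x‖ := by
  rw [xi, inner_smul_right, real_inner_self_eq_norm_sq, sq]
  rcases eq_or_ne ‖vorticity u t x‖ 0 with h | h
  · simp [h]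
  · field_simp

/-- The growth of the vorticity magnitude along a particle trajectory. -/
theorem IsEulerSolution.hasDerivWithinAt_norm_vorticity (hu : IsEulerSolution u p T) {J : Set ℝ}
    (hJ : J ⊆ Ico 0 T) {y : ℝ → E3} (ht : t ∈ J) (hy : HasDerivWithinAt y (u t (y t)) J t)
    (h0 : vorticity u t (y t) ≠ 0) :
    HasDerivWithinAt (fun r => ‖vorticity u r (y r)‖)
      (stretching u t (y t) * ‖vorticity u t (y t)‖) J t := by
  have hpos := norm_pos_iff.2 h0
  have h := ((hu.hasDerivWithinAt_vorticity hJ ht hy).norm_sq).sqrt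
    (by positivity : ‖vorticity u t (y t)‖ ^ 2 ≠ 0)
  simp only [Real.sqrt_sq (norm_nonneg _)] at h
  refine h.congr_deriv ?_
  rw [stretching, xi, map_smul, inner_smul_left, inner_smul_right, real_inner_comm]
  simp only [conj_trivial]
  field_simp

/-- The change of parameter between labels and arclength. -/
theorem IsVortexLine.hasDerivWithinAt_param {c z : ℝ → E3} {σ : ℝ → ℝ} {ℓ b₁ b₂ k β : ℝ}
    (hc : IsVortexLine u t (Icc 0 ℓ) c) (hb : b₁ < b₂) (hσ : ContinuousOn σ (Icc b₁ b₂))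
    (hσm : MapsTo σ (Icc b₁ b₂) (Icc 0 ℓ)) (hz : ∀ β ∈ Icc b₁ b₂, c (σ β) = z β)
    (hβ : β ∈ Icc b₁ b₂)
    (hz' : HasDerivWithinAt z (k • vorticity u t (z β)) (Icc b₁ b₂) β) :
    HasDerivWithinAt σ (k * ‖vorticity u t (z β)‖) (Icc b₁ b₂) β := by
  obtain ⟨h0, h1⟩ := hc.2 (σ β) (hσm hβ)
  have hξ : xi u t (c (σ β)) ≠ 0 := norm_ne_zero_iff.1 (by rw [norm_xi h0]; norm_num)
  -- The relation c(σ(β)) = z(β) is treated as an implicit equation whose map does not depend on its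
  -- first variable. As c' = ξ ≠ 0, the merely continuous σ is differentiable, and comparing
  -- multiples of ξ gives its derivative.
  have hΦ : HasFDerivWithinAt (fun q : ℝ × ℝ => c q.2)
      ((ContinuousLinearMap.fst ℝ ℝ ℝ).smulRight (0 : E3) +
        (ContinuousLinearMap.snd ℝ ℝ ℝ).smulRight (xi u t (c (σ β))))
      (Icc b₁ b₂ ×ˢ Icc 0 ℓ) (β, σ β) :=
    hasFDerivWithinAt_prod_of_uniform (F := fun _ s => c s) (Ft := fun _ => 0)
      (fun ε hε => Eventually.of_forall fun r s _ => by simp; positivity)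
      continuousWithinAt_const h1
  obtain ⟨d, hd, he⟩ := exists_hasDerivWithinAt_of_hasFDerivWithinAt
    (uniqueDiffOn_Icc hb β hβ) hΦ hξ (hσ β hβ) hσm (hz'.congr hz (hz β hβ))
  rw [zero_add, ← hz β hβ, ← norm_smul_xi h0, smul_smul] at he
  rw [← hz β hβ, smul_left_injective ℝ hξ he]
  exact hd

/-- Change of variables from labels to arclength. -/
theorem integral_comp_param {c z : ℝ → E3} {σ : ℝ → ℝ} {g : E3 → ℝ} {σ' : ℝ → ℝ}
    {ℓ b₁ b₂ : ℝ} (hb : b₁ < b₂) (hσ' : ContinuousOn σ' (Icc b₁ b₂))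
    (hσ : ∀ β ∈ Icc b₁ b₂, HasDerivWithinAt σ (σ' β) (Icc b₁ b₂) β)
    (hσm : MapsTo σ (Icc b₁ b₂) (Icc 0 ℓ)) (h₁ : σ b₁ = 0) (h₂ : σ b₂ = ℓ)
    (hz : ∀ β ∈ Icc b₁ b₂, c (σ β) = z β) (hg : ContinuousOn (fun s => g (c s)) (Icc 0 ℓ)) :
    ∫ β in b₁..b₂, g (z β) * σ' β = ∫ s in (0 : ℝ)..ℓ, g (c s) := by
  have hI : uIcc b₁ b₂ = Icc b₁ b₂ := uIcc_of_le hb.le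
  have h := intervalIntegral.integral_comp_mul_deriv'' (f := σ) (f' := σ') (a := b₁) (b := b₂)
    (g := fun s => g (c s))
    (by rw [hI]; exact fun β hβ => (hσ β hβ).continuousWithinAt)
    (fun β hβ => by
      rw [min_eq_left hb.le, max_eq_right hb.le] at hβ
      exact ((hσ β (Ioo_subset_Icc_self hβ)).hasDerivAt
        (Icc_mem_nhds hβ.1 hβ.2)).hasDerivWithinAt)
    (by rwa [hI]) (by rw [hI]; exact hg.mono hσm.image_subset)
  rw [h₁, h₂] at h
  rw [← h]
  refine intervalIntegral.integral_congr fun β hβ => ?_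
  rw [hI] at hβ
  simp only [Function.comp_apply, hz β hβ]

/-- Integrals over a moving piece `[β₁, β₂]` of a parameter interval: if the integral of the
nonvanishing function `G` and the point `Y` at the label `β₁` are differentiable, then so are
the end labels, and hence the integral of any other function `H`. -/
theorem exists_hasDerivWithinAt_integral_of_moving_piece {E : Type*} [NormedAddCommGroup E]
    [NormedSpace ℝ E] {J : Set ℝ} {a b t Lt : ℝ} {β₁ β₂ : ℝ → ℝ} {G G' H H' : ℝ → ℝ → ℝ}
    {Y Y' : ℝ → ℝ → E} {v y : E} (hJ : Convex ℝ J) (huniq : UniqueDiffWithinAt ℝ J t) (ht : t ∈ J)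
    (hm₁ : MapsTo β₁ J (Icc a b)) (hm₂ : MapsTo β₂ J (Icc a b))
    (hβ₁ : ContinuousWithinAt β₁ J t) (hβ₂ : ContinuousWithinAt β₂ J t)
    (hGt : ∀ β ∈ Icc a b, ∀ r ∈ J, HasDerivWithinAt (fun r => G r β) (G' r β) J r)
    (hGc : ∀ r ∈ J, ContinuousOn (G r) (Icc a b))
    (hG'c : ContinuousOn (fun q : ℝ × ℝ => G' q.1 q.2) (J ×ˢ Icc a b))
    (hHt : ∀ β ∈ Icc a b, ∀ r ∈ J, HasDerivWithinAt (fun r => H r β) (H' r β) J r)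
    (hHc : ∀ r ∈ J, ContinuousOn (H r) (Icc a b))
    (hH'c : ContinuousOn (fun q : ℝ × ℝ => H' q.1 q.2) (J ×ˢ Icc a b))
    (hYt : ∀ β ∈ Icc a b, ∀ r ∈ J, HasDerivWithinAt (fun r => Y r β) (Y' r β) J r)
    (hY'c : ContinuousOn (fun q : ℝ × ℝ => Y' q.1 q.2) (J ×ˢ Icc a b))
    (hYβ : HasDerivWithinAt (Y t) v (Icc a b) (β₁ t)) (hv : v ≠ 0) (hG0 : G t (β₂ t) ≠ 0)
    (hy : HasDerivWithinAt (fun r => Y r (β₁ r)) y J t)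
    (hL : HasDerivWithinAt (fun r => ∫ β in β₁ r..β₂ r, G r β) Lt J t) :
    ∃ c₁ c₂ : ℝ,
      HasDerivWithinAt (fun r => ∫ β in β₁ r..β₂ r, H r β)
        ((∫ β in β₁ t..β₂ t, H' t β) + c₂ * H t (β₂ t) - c₁ * H t (β₁ t)) J t ∧
      Lt = (∫ β in β₁ t..β₂ t, G' t β) + c₂ * G t (β₂ t) - c₁ * G t (β₁ t) ∧
      y = Y' t (β₁ t) + c₁ • v := by
  have hpair : ContinuousOn (fun β : ℝ => (t, β)) (Icc a b) :=
    continuousOn_const.prodMk continuousOn_id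
  have hmaps : MapsTo (fun β : ℝ => (t, β)) (Icc a b) (J ×ˢ Icc a b) := fun β hβ => ⟨ht, hβ⟩
  have hsub : ∀ {f : ℝ → ℝ}, ContinuousOn f (Icc a b) → ∀ r ∈ J,
      (∫ β in a..β₂ r, f β) - ∫ β in a..β₁ r, f β = ∫ β in β₁ r..β₂ r, f β :=
    fun hf r hr => intervalIntegral.integral_interval_sub_left
      ((hf.mono (Icc_subset_Icc_right (hm₂ hr).2)).intervalIntegrable_of_Icc (hm₂ hr).1)
      ((hf.mono (Icc_subset_Icc_right (hm₁ hr).2)).intervalIntegrable_of_Icc (hm₁ hr).1)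
  have hYD := hasFDerivWithinAt_prod_of_uniform (F := Y) (Ft := Y' t)
    (fun ε hε => eventually_forall_norm_sub_sub_le hJ ht isCompact_Icc hYt hY'c hε)
    (hY'c.comp hpair hmaps (β₁ t) (hm₁ ht)) hYβ
  -- The left end point is differentiable and ∂_βY = v ≠ 0, hence so is its label β₁.
  obtain ⟨c₁, hc₁, hxt⟩ :=
    exists_hasDerivWithinAt_of_hasFDerivWithinAt huniq hYD hv hβ₁ hm₁ hy
  have hGD := fun β hβ => hasFDerivWithinAt_integral_prod (b := β) hJ ht hβ hGt hGc hG'c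
  have hHD := fun β hβ => hasFDerivWithinAt_integral_prod (b := β) hJ ht hβ hHt hHc hH'c
  have hchain : ∀ {F : ℝ × ℝ → ℝ} {A v c : ℝ} {β : ℝ → ℝ}, MapsTo β J (Icc a b) →
      HasDerivWithinAt β c J t →
      HasFDerivWithinAt F ((ContinuousLinearMap.fst ℝ ℝ ℝ).smulRight A +
        (ContinuousLinearMap.snd ℝ ℝ ℝ).smulRight v) (J ×ˢ Icc a b) (t, β t) →
      HasDerivWithinAt (fun r => F (r, β r)) (A + c * v) J t :=
    fun {F A v c β} hm hβ hF =>
      (HasFDerivWithinAt.comp_hasDerivWithinAt (f := fun r => (r, β r)) t hF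
        ((hasDerivWithinAt_id t _).prodMk hβ) (fun r hr => ⟨hr, hm hr⟩)).congr_deriv (by simp)
  have hG₁ := hchain hm₁ hc₁ (hGD _ (hm₁ ht))
  -- Once β₁ is differentiable, adding the integral over [a, β₁] to the one over [β₁, β₂] gives a
  -- differentiable integral with fixed lower end. Its derivative in the upper end is G ≠ 0, so β₂
  -- is differentiable too.
  have hG₂ : HasDerivWithinAt (fun r => ∫ β in a..β₂ r, G r β)
      (Lt + ((∫ β in a..β₁ t, G' t β) + c₁ * G t (β₁ t))) J t :=
    (hL.add hG₁).congr (fun r hr => by simp [← hsub (hGc r hr) r hr])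
      (by simp [← hsub (hGc t ht) t ht])
  obtain ⟨c₂, hc₂, hLt⟩ := exists_hasDerivWithinAt_of_hasFDerivWithinAt huniq
    (hGD _ (hm₂ ht)) hG0 hβ₂ hm₂ hG₂
  refine ⟨c₁, c₂, ?_, ?_, hxt⟩
  · have h1 := (hchain hm₂ hc₂ (hHD _ (hm₂ ht))).sub (hchain hm₁ hc₁ (hHD _ (hm₁ ht)))
    refine (h1.congr (fun r hr => (hsub (hHc r hr) r hr).symm)
      (hsub (hHc t ht) t ht).symm).congr_deriv ?_
    rw [← hsub (f := H' t) (hH'c.comp hpair hmaps) t ht]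
    ring
  · rw [smul_eq_mul] at hLt
    rw [← hsub (f := G' t) (hG'c.comp hpair hmaps) t ht]
    linarith

/-- The evolution of the length and of the total vorticity of a family of vortex line
segments, in terms of the tangential velocities `e₁`, `e₂` of the end points relative to the
fluid. -/
theorem IsVortexSegmentFamily.exists_endpoint_velocities (hT₀ : 0 ≤ T₀)
    (hu : IsEulerSolution u p T) {x : ℝ → ℝ → E3} {L : ℝ → ℝ}
    (hx : IsVortexSegmentFamily u T₀ T x L) (ht : t ∈ Ico T₀ T) {Lt : ℝ}
    (hL : HasDerivWithinAt L Lt (Ico T₀ T) t) {xt : E3}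
    (hx0 : HasDerivWithinAt (fun r => x 0 r) xt (Ico T₀ T) t) :
    ∃ e₁ e₂ : ℝ,
      HasDerivWithinAt (fun r => ∫ s in (0 : ℝ)..(L r), ‖vorticity u r (x s r)‖)
        ((∫ s in (0 : ℝ)..(L t), 2 * (stretching u t (x s t) * ‖vorticity u t (x s t)‖))
          + ‖vorticity u t (x (L t) t)‖ * e₂ - ‖vorticity u t (x 0 t)‖ * e₁) (Ico T₀ T) t ∧
      Lt = (∫ s in (0 : ℝ)..(L t), stretching u t (x s t)) + e₂ - e₁ ∧
      inner ℝ xt (xi u t (x 0 t)) = uXi u t (x 0 t) + e₁ := by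
  obtain ⟨I, γ, X, β₁, β₂, σ, hγ, hX, hβ₁, hβ₂, hall⟩ := hx.same_line
  -- A compact time interval containing a relative neighbourhood of `t` leaves the derivative at `t`
  -- unchanged and supplies the compactness that [T₀, T) lacks.
  obtain ⟨t₁, htt₁, ht₁T⟩ := exists_between ht.2
  have htJ : t ∈ Icc T₀ t₁ := ⟨ht.1, htt₁.le⟩
  have hJ : Icc T₀ t₁ ⊆ Ico T₀ T := fun r hr => ⟨hr.1, hr.2.trans_lt ht₁T⟩
  have hJ0 : Icc T₀ t₁ ⊆ Ico 0 T := Icc_subset_Ico_of_lt hT₀ ht₁T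
  have hT₀t₁ : T₀ < t₁ := ht.1.trans_lt htt₁
  have hnhds : Icc T₀ t₁ ∈ 𝓝[Ico T₀ T] t := by
    refine mem_nhdsWithin.2 ⟨Iio t₁, isOpen_Iio, htt₁, fun r hr => ⟨hr.2.1, (le_of_lt hr.1)⟩⟩
  -- a compact interval of labels that contains all pieces
  obtain ⟨r₁, hr₁, hmin⟩ := isCompact_Icc.exists_isMinOn (nonempty_Icc.2 hT₀t₁.le)
    (hβ₁.mono hJ)
  obtain ⟨r₂, hr₂, hmax⟩ := isCompact_Icc.exists_isMaxOn (nonempty_Icc.2 hT₀t₁.le)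
    (hβ₂.mono hJ)
  set a := β₁ r₁ with ha
  set b := β₂ r₂ with hb
  have hab : Icc a b ⊆ I := hγ.1.out (hall r₁ (hJ hr₁)).1 (hall r₂ (hJ hr₂)).2.1
  have hm₁ : MapsTo β₁ (Icc T₀ t₁) (Icc a b) := fun r hr =>
    ⟨isMinOn_iff.1 hmin r hr, (hall r (hJ hr)).2.2.1.le.trans (isMaxOn_iff.1 hmax r hr)⟩
  have hm₂ : MapsTo β₂ (Icc T₀ t₁) (Icc a b) := fun r hr =>
    ⟨(isMinOn_iff.1 hmin r hr).trans (hall r (hJ hr)).2.2.1.le, isMaxOn_iff.1 hmax r hr⟩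
  have hpiece : ∀ r ∈ Icc T₀ t₁, Icc (β₁ r) (β₂ r) ⊆ Icc a b := fun r hr =>
    Icc_subset_Icc (hm₁ hr).1 (hm₂ hr).2
  -- quantities on the flow image of the vortex line
  have hY := (hu.continuousOn_flow hT₀ ht₁T hγ hX).mono
    (prod_mono_right hab : Icc T₀ t₁ ×ˢ Icc a b ⊆ Icc T₀ t₁ ×ˢ I)
  have hYt : ∀ β ∈ Icc a b, ∀ r ∈ Icc T₀ t₁,
      HasDerivWithinAt (fun r => X r (γ β)) (u r (X r (γ β))) (Icc T₀ t₁) r := fun β hβ =>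
    hX.hasDerivWithinAt_Icc ht₁T (mem_image_of_mem γ (hab hβ))
  have hω0 : ∀ r ∈ Icc T₀ t₁, ∀ β ∈ Icc a b, vorticity u r (X r (γ β)) ≠ 0 := fun r hr β hβ =>
    hu.vorticity_ne_zero hT₀ ht₁T (hYt β hβ) (by
      rw [(hX _ (mem_image_of_mem γ (hab hβ))).1]; exact (hγ.2 β (hab hβ)).1) hr
  have hpair : ContinuousOn (fun q : ℝ × ℝ => (q.1, X q.1 (γ q.2)))
      (Icc T₀ t₁ ×ˢ Icc a b) := continuousOn_fst.prodMk hY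
  have hpm : MapsTo (fun q : ℝ × ℝ => (q.1, X q.1 (γ q.2))) (Icc T₀ t₁ ×ˢ Icc a b)
      (Ico 0 T ×ˢ univ) := fun q hq => ⟨hJ0 hq.1, mem_univ _⟩
  have hωc : ContinuousOn (fun q : ℝ × ℝ => vorticity u q.1 (X q.1 (γ q.2)))
      (Icc T₀ t₁ ×ˢ Icc a b) := hu.contDiffOn_vorticity.continuousOn.comp hpair hpm
  have hξc : ContinuousOn (fun q : ℝ × ℝ => xi u q.1 (X q.1 (γ q.2)))
      (Icc T₀ t₁ ×ˢ Icc a b) :=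
    (hωc.norm.inv₀ fun q hq => norm_ne_zero_iff.2 (hω0 q.1 hq.1 q.2 hq.2)).smul hωc
  have hαc : ContinuousOn (fun q : ℝ × ℝ => stretching u q.1 (X q.1 (γ q.2)))
      (Icc T₀ t₁ ×ˢ Icc a b) :=
    ((hu.contDiffOn_spatial.continuousOn.comp hpair hpm).clm_apply hξc).inner (𝕜 := ℝ) hξc
  have huc : ContinuousOn (fun q : ℝ × ℝ => u q.1 (X q.1 (γ q.2)))
      (Icc T₀ t₁ ×ˢ Icc a b) := hu.regular.continuousOn.comp hpair hpm
  set w : ℝ → ℝ := fun β => ‖vorticity u T₀ (γ β)‖⁻¹ with hw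
  have hw0 : ∀ β ∈ Icc a b, 0 < w β := fun β hβ =>
    inv_pos.2 (norm_pos_iff.2 (hγ.2 β (hab hβ)).1)
  have hwc : ContinuousOn w (Icc a b) :=
    ((hγ.continuousOn_norm_vorticity hu ⟨hT₀, ht.1.trans_lt ht.2⟩).mono hab).inv₀ fun β hβ =>
      norm_ne_zero_iff.2 (hγ.2 β (hab hβ)).1
  have hwc' : ContinuousOn (fun q : ℝ × ℝ => w q.2) (Icc T₀ t₁ ×ˢ Icc a b) :=
    hwc.comp continuousOn_snd fun q hq => hq.2
  -- `G` is the arclength density ds/dβ, so L is the integral of `G` and the total vorticity is that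
  -- of `H`. The second factor |ω| in `H` doubles the stretching rate in `H'`.
  set G : ℝ → ℝ → ℝ := fun r β => w β * ‖vorticity u r (X r (γ β))‖ with hG
  set G' : ℝ → ℝ → ℝ := fun r β => stretching u r (X r (γ β)) * G r β with hG'
  set H : ℝ → ℝ → ℝ := fun r β => ‖vorticity u r (X r (γ β))‖ * G r β with hH
  set H' : ℝ → ℝ → ℝ := fun r β =>
    2 * (stretching u r (X r (γ β)) * ‖vorticity u r (X r (γ β))‖) * G r β with hH'
  have hGc : ContinuousOn (fun q : ℝ × ℝ => G q.1 q.2) (Icc T₀ t₁ ×ˢ Icc a b) :=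
    hwc'.mul hωc.norm
  have hG'c : ContinuousOn (fun q : ℝ × ℝ => G' q.1 q.2) (Icc T₀ t₁ ×ˢ Icc a b) := hαc.mul hGc
  have hHc : ContinuousOn (fun q : ℝ × ℝ => H q.1 q.2) (Icc T₀ t₁ ×ˢ Icc a b) :=
    hωc.norm.mul hGc
  have hH'c : ContinuousOn (fun q : ℝ × ℝ => H' q.1 q.2) (Icc T₀ t₁ ×ˢ Icc a b) :=
    ((hαc.mul hωc.norm).const_smul (2 : ℝ)).mul hGc
  have hslice : ∀ {f : ℝ → ℝ → ℝ}, ContinuousOn (fun q : ℝ × ℝ => f q.1 q.2)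
      (Icc T₀ t₁ ×ˢ Icc a b) → ∀ r ∈ Icc T₀ t₁, ContinuousOn (f r) (Icc a b) :=
    fun hf r hr => hf.comp (continuousOn_const.prodMk continuousOn_id) fun β hβ => ⟨hr, hβ⟩
  have hGt : ∀ β ∈ Icc a b, ∀ r ∈ Icc T₀ t₁,
      HasDerivWithinAt (fun r => G r β) (G' r β) (Icc T₀ t₁) r := fun β hβ r hr =>
    ((hu.hasDerivWithinAt_norm_vorticity hJ0 hr (hYt β hβ r hr)
      (hω0 r hr β hβ)).const_mul (w β)).congr_deriv (by simp only [hG', hG]; ring)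
  have hHt : ∀ β ∈ Icc a b, ∀ r ∈ Icc T₀ t₁,
      HasDerivWithinAt (fun r => H r β) (H' r β) (Icc T₀ t₁) r := fun β hβ r hr =>
    ((hu.hasDerivWithinAt_norm_vorticity hJ0 hr (hYt β hβ r hr)
      (hω0 r hr β hβ)).mul (hGt β hβ r hr)).congr_deriv (by simp only [hG', hH']; ring)
  -- change of variables
  have hσ : ∀ r ∈ Icc T₀ t₁, ∀ β ∈ Icc (β₁ r) (β₂ r), HasDerivWithinAt (fun β => σ β r)
      (G r β) (Icc (β₁ r) (β₂ r)) β := fun r hr β hβ => by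
    obtain ⟨-, -, hlt, hσc, hσm, -, -, hσx⟩ := hall r (hJ hr)
    exact (hx.segment r (hJ hr)).hasDerivWithinAt_param (σ := fun β => σ β r)
      (z := fun β => X r (γ β)) (k := w β) hlt hσc hσm hσx hβ
      ((hu.hasDerivWithinAt_flow hT₀ hγ hX (hJ hr) (hab (hpiece r hr hβ))).mono
        ((hpiece r hr).trans hab))
  have hcv : ∀ r ∈ Icc T₀ t₁, ∀ g : E3 → ℝ,
      ContinuousOn (fun s => g (x s r)) (Icc 0 (L r)) →
      ∫ β in β₁ r..β₂ r, g (X r (γ β)) * G r β = ∫ s in (0 : ℝ)..(L r), g (x s r) :=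
    fun r hr g hg => by
      obtain ⟨-, -, hlt, -, hσm, hs₁, hs₂, hσx⟩ := hall r (hJ hr)
      exact integral_comp_param hlt ((hslice hGc r hr).mono (hpiece r hr)) (hσ r hr) hσm hs₁ hs₂
        hσx hg
  have hLr : ∀ r ∈ Icc T₀ t₁, ∫ β in β₁ r..β₂ r, G r β = L r := fun r hr => by
    simpa using hcv r hr (fun _ => 1) continuousOn_const
  have hNr : ∀ r ∈ Icc T₀ t₁, ∫ s in (0 : ℝ)..(L r), ‖vorticity u r (x s r)‖ =
      ∫ β in β₁ r..β₂ r, H r β := fun r hr =>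
    (hcv r hr (fun y => ‖vorticity u r y‖)
      ((hx.segment r (hJ hr)).continuousOn_norm_vorticity hu (hJ0 hr))).symm
  have hseg := hx.segment t ht
  have hGi : ∫ β in β₁ t..β₂ t, G' t β = ∫ s in (0 : ℝ)..(L t), stretching u t (x s t) :=
    hcv t htJ _ (hseg.continuousOn_comp fun _ => hu.continuousAt_stretching (hJ0 htJ))
  have hHi : ∫ β in β₁ t..β₂ t, H' t β =
      ∫ s in (0 : ℝ)..(L t), 2 * (stretching u t (x s t) * ‖vorticity u t (x s t)‖) :=
    hcv t htJ (fun y => 2 * (stretching u t y * ‖vorticity u t y‖))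
      (((hseg.continuousOn_comp fun _ => hu.continuousAt_stretching (hJ0 htJ)).mul
        (hseg.continuousOn_norm_vorticity hu (hJ0 htJ))).const_smul (2 : ℝ))
  have hX₁ : ∀ r ∈ Icc T₀ t₁, X r (γ (β₁ r)) = x 0 r := fun r hr => by
    obtain ⟨-, -, hlt, -, -, hs₁, -, hσx⟩ := hall r (hJ hr)
    rw [← hσx _ (left_mem_Icc.2 hlt.le), hs₁]
  have hX₂ : X t (γ (β₂ t)) = x (L t) t := by
    obtain ⟨-, -, hlt, -, -, -, hs₂, hσx⟩ := hall t ht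
    rw [← hσx _ (right_mem_Icc.2 hlt.le), hs₂]
  obtain ⟨c₁, c₂, hN, hLt, hxt⟩ := exists_hasDerivWithinAt_integral_of_moving_piece
    (Y := fun r β => X r (γ β)) (Y' := fun r β => u r (X r (γ β))) (convex_Icc T₀ t₁)
    (uniqueDiffOn_Icc hT₀t₁ t htJ) htJ hm₁ hm₂ ((hβ₁.mono hJ) t htJ) ((hβ₂.mono hJ) t htJ)
    hGt (hslice hGc) hG'c hHt (hslice hHc) hH'c hYt huc
    ((hu.hasDerivWithinAt_flow hT₀ hγ hX ht (hab (hm₁ htJ))).mono hab)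
    (smul_ne_zero (hw0 _ (hm₁ htJ)).ne' (hω0 t htJ _ (hm₁ htJ)))
    (mul_ne_zero (hw0 _ (hm₂ htJ)).ne' (norm_ne_zero_iff.2 (hω0 t htJ _ (hm₂ htJ))))
    ((hx0.mono hJ).congr hX₁ (hX₁ t htJ)) ((hL.mono hJ).congr hLr (hLr t htJ))
  rw [hGi] at hLt
  rw [hHi] at hN
  -- Label speeds times ds/dβ are the arclength speeds of the end points relative to the fluid.
  refine ⟨c₁ * G t (β₁ t), c₂ * G t (β₂ t), ?_, hLt, ?_⟩
  · refine ((hN.congr hNr (hNr t htJ)).mono_of_mem_nhdsWithin hnhds).congr_deriv ?_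
    rw [← hX₂, ← hX₁ t htJ]
    simp only [hH]
    ring
  · rw [hxt, ← hX₁ t htJ, inner_add_left, inner_smul_left, inner_smul_left, inner_vorticity_xi]
    simp only [conj_trivial, hG, hw, uXi]

end Transport

end VortexSegment

/-! ### The derivative of the mean vorticity. -/

theorem mainTheorem8
    (u : ℝ → VortexSegment.E3 → VortexSegment.E3) (p : ℝ → VortexSegment.E3 → ℝ)
    (T₀ T : ℝ) (hT₀ : 0 ≤ T₀) (hu : VortexSegment.IsEulerSolution u p T)
    (x : ℝ → ℝ → VortexSegment.E3) (L : ℝ → ℝ)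
    (hx : VortexSegment.IsVortexSegmentFamily u T₀ T x L)
    (t : ℝ) (ht : t ∈ Set.Ico T₀ T)
    (Lt : ℝ) (hL : HasDerivWithinAt L Lt (Set.Ico T₀ T) t)
    (xt : VortexSegment.E3)
    (hx0 : HasDerivWithinAt (fun r => x 0 r) xt (Set.Ico T₀ T) t) :
    IntervalIntegrable (fun s => ‖VortexSegment.vorticity u t (x s t)‖) volume 0 (L t) ∧
    IntervalIntegrable (fun s => 2 * VortexSegment.tau u t (x s t) *
      ‖VortexSegment.vorticity u t (x s t)‖ * VortexSegment.uXi u t (x s t)) volume 0 (L t) ∧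
    IntervalIntegrable (fun s => VortexSegment.kappa u t (x s t) *
      ‖VortexSegment.vorticity u t (x s t)‖ * VortexSegment.uXiPerp u t (x s t))
      volume 0 (L t) ∧
    IntervalIntegrable (fun s => VortexSegment.kappa u t (x s t) *
      (‖VortexSegment.vorticity u t (x s t)‖ - ‖VortexSegment.vorticity u t (x (L t) t)‖) *
      VortexSegment.uXiPerp u t (x s t)) volume 0 (L t) ∧
    HasDerivWithinAt (VortexSegment.meanVorticity u x L)
      (1 / L t *
          ((∫ s in (0 : ℝ)..(L t), 2 * VortexSegment.tau u t (x s t) *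
              ‖VortexSegment.vorticity u t (x s t)‖ * VortexSegment.uXi u t (x s t))
            - (∫ s in (0 : ℝ)..(L t), VortexSegment.kappa u t (x s t) *
              ‖VortexSegment.vorticity u t (x s t)‖ * VortexSegment.uXiPerp u t (x s t))
            - (∫ s in (0 : ℝ)..(L t), VortexSegment.kappa u t (x s t) *
              (‖VortexSegment.vorticity u t (x s t)‖
                - ‖VortexSegment.vorticity u t (x (L t) t)‖) *
              VortexSegment.uXiPerp u t (x s t)))
        + 1 / L t *
          (VortexSegment.uXi u t (x (L t) t) - VortexSegment.uXi u t (x 0 t)) *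
          ‖VortexSegment.vorticity u t (x (L t) t)‖
        + 1 / L t *
          (‖VortexSegment.vorticity u t (x (L t) t)‖ - ‖VortexSegment.vorticity u t (x 0 t)‖) *
          (inner ℝ xt (VortexSegment.xi u t (x 0 t)) + VortexSegment.uXi u t (x 0 t))
        + Lt / L t *
          (‖VortexSegment.vorticity u t (x (L t) t)‖ - VortexSegment.meanVorticity u x L t))
      (Set.Ico T₀ T) t := by
  have ht0 : t ∈ Ico 0 T := ⟨hT₀.trans ht.1, ht.2⟩
  have hLpos := hx.length_pos t ht
  have hseg := hx.segment t ht
  obtain ⟨e₁, e₂, hN, hLt, hxt⟩ := hx.exists_endpoint_velocities hT₀ hu ht hL hx0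
  have h1 := hseg.continuousOn_norm_vorticity hu ht0
  have h2 := hseg.continuousOn_comp fun _ => hu.continuousAt_kappa_mul_uXiPerp ht0
  have i1 := h1.intervalIntegrable_of_Icc (μ := volume) hLpos.le
  have i2 := (hseg.continuousOn_tau_integrand hu ht0).intervalIntegrable_of_Icc
    (μ := volume) hLpos.le
  have i3 := (hseg.continuousOn_kappa_integrand hu ht0).intervalIntegrable_of_Icc
    (μ := volume) hLpos.le
  have i4 := (h2.intervalIntegrable_of_Icc (μ := volume) hLpos.le).const_mul
    ‖VortexSegment.vorticity u t (x (L t) t)‖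
  have hsplit : (fun s => VortexSegment.kappa u t (x s t) *
      (‖VortexSegment.vorticity u t (x s t)‖ - ‖VortexSegment.vorticity u t (x (L t) t)‖) *
      VortexSegment.uXiPerp u t (x s t)) = fun s =>
      VortexSegment.kappa u t (x s t) * ‖VortexSegment.vorticity u t (x s t)‖ *
        VortexSegment.uXiPerp u t (x s t) - ‖VortexSegment.vorticity u t (x (L t) t)‖ *
        (VortexSegment.kappa u t (x s t) * VortexSegment.uXiPerp u t (x s t)) := by
    ext s; ring
  refine ⟨i1, i2, i3, by rw [hsplit]; exact i3.sub i4, ?_⟩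
  have hQ := ((hasDerivWithinAt_const t (Set.Ico T₀ T) (1 : ℝ)).div hL hLpos.ne').mul hN
  refine hQ.congr_deriv ?_
  -- Expressing L_t and x_t·ξ through e₁, e₂ and replacing the stretching integrals by boundary
  -- terms and the τ, κ integrals reduces both sides to a rational identity in the same quantities.
  rw [hsplit, intervalIntegral.integral_sub i3 i4, intervalIntegral.integral_const_mul
    ‖VortexSegment.vorticity u t (x (L t) t)‖, hxt, hLt, hu.integral_stretching ht0 hLpos.le hseg,
    hu.integral_stretching_mul ht0 hLpos.le hseg, VortexSegment.meanVorticity, Pi.div_apply]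
  field_simp
  ring
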